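/- Let $\alpha,u_0>0$, let $u_\pm\in\mathbb C$ with $|u_\pm|=u_0$, and let $u(x,t)$ be a function (for instance a solution of $iu_t+u_{xx}+4i\alpha u_x+\frac{i}{\alpha}(|u|^2u)_x=0$) that for every $t$ is continuous in $x\in\mathbb R$ with $u(\cdot,t)-u_-\in L^1(-\infty,0)$ and $u(\cdot,t)-u_+\in L^1(0,\infty)$. A star denotes (entrywise) complex conjugation. Put $$\sigma_1=\begin{pmatrix}0&1\\1&0\end{pmatrix},\quad \sigma_3=\begin{pmatrix}1&0\\0&-1\end{pmatrix},\quad \sigma_*=\begin{pmatrix}0&1\\-1&0\end{pmatrix},\quad Q=\begin{pmatrix}0&u\\u^*&0\end{pmatrix},\quad Q_\pm=\begin{pmatrix}0&u_\pm\\u_\pm^*&0\end{pmatrix},$$ $$k(z)=\tfrac1{2\alpha}\Big(z-\tfrac{u_0^2}{z}\Big),\quad \lambda(z)=\tfrac12\Big(z+\tfrac{u_0^2}{z}\Big),\quad \theta=-k\lambda\Big[x+\Big(2\alpha k^2-4\alpha-\tfrac{u_0^2}{\alpha}\Big)t\Big],\quad Y_\pm=I+\tfrac1z\sigma_3Q_\pm,\quad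 \gamma=\det Y_\pm=1+\tfrac{u_0^2}{z^2},$$ $\Delta X_\pm=ik(Q-Q_\pm)$, $e^{a\hat\sigma_3}A=e^{a\sigma_3}Ae^{-a\sigma_3}$. Let $D^\pm=\{\mp\,\mathrm{Re}\,z\,\mathrm{Im}\,z>0\}$ and $\Sigma=(\mathbb R\cup i\mathbb R)\setminus\{0\}$; the points $z=0$ and $z=\pm iu_0$ are always excluded. The Jost solutions $\varphi_\pm=(\varphi_{\pm,1},\varphi_{\pm,2})$ are the solutions with $\varphi_\pm\to Y_\pm$ as $x\to\pm\infty$ of $$\varphi_-(x)=Y_-+\int_{-\infty}^xY_-e^{-ik\lambda(x-y)\hat\sigma_3}[Y_-^{-1}\Delta X_-\varphi_-](y)\,dy,\qquad \varphi_+(x)=Y_+-\int_x^{\infty}Y_+e^{-ik\lambda(x-y)\hat\sigma_3}[Y_+^{-1}\Delta X_+\varphi_+](y)\,dy,$$ understood column by column, with absolutely convergent integrals. For every $t$ the columns $\varphi_{+,1},\varphi_{-,2}$ exist and are unique for $z\in D^+\cup\Sigma$, and so do $\varphi_{-,1},\varphi_{+,2}$ for $z\in D^-\cup\Sigma$. With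 $\phi_\pm=\varphi_\pm e^{i\theta\sigma_3}$, for each $z\in\Sigma$ there is exactly one matrix $S=(s_{ij})$ (the scattering matrix of $u(\cdot,t)$) with $\phi_+=\phi_-S$ for all $x$; moreover $s_{11}=\det(\varphi_{+,1},\varphi_{-,2})/\gamma$ and $s_{22}=\det(\varphi_{-,1},\varphi_{+,2})/\gamma$, independently of $x$, which defines $s_{11}$ on $D^+\cup\Sigma$ and $s_{22}$ on $D^-\cup\Sigma$. Put $\rho=s_{21}/s_{11}$ and $\tilde\rho=s_{12}/s_{22}$. Then the following hold for all $x,t$ and all $z\ne 0,\pm iu_0$ for which the quantities involved are defined (the matrix identities being read column by column for $\varphi_\pm$ and entry by entry for $S$): 1. $\varphi_\pm(x,t,z)=-\sigma_*\varphi_\pm^*(x,t,z^*)\sigma_*$, $\;S(z)=-\sigma_*S^*(z^*)\sigma_*$, $\;\rho(z)=-\tilde\rho^*(z^*)$; 2. $\varphi_\pm(x,t,z)=\sigma_1\varphi_\pm^*(x,t,-z^*)\sigma_1$, $\;S(z)=\sigma_1S^*(-z^*)\sigma_1$, $\;\rho(z)=\tilde\rho^*(-z^*)$; 3. $\varphi_\pm(x,t,z)=\frac1z\varphi_\pm\big(x,t,-\frac{u_0^2}{z}\big)\sigma_3Q_\pm$,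 $\;S(z)=(\sigma_3Q_-)^{-1}S\big(-\frac{u_0^2}{z}\big)\sigma_3Q_+$, $\;\rho(z)=-\frac{u_-^*}{u_-}\tilde\rho\big(-\frac{u_0^2}{z}\big)$. Consequently $s_{11}$ and $s_{22}$ are even functions of $z$, and $s_{12}$ and $s_{21}$ are odd. -/

import Mathlib

open scoped ComplexConjugate
open MeasureTheory Filter Topology Set Matrix

namespace MNLS

noncomputable section

/-- The two ends `x → -∞` and `x → +∞` of the line, i.e. the subscripts `-` and `+`. -/
inductive Side
  | minus
  | plus

/-- The half-line between `x` and the given end. -/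
def Side.halfLine : Side → ℝ → Set ℝ
  | .minus, x => Iic x
  | .plus, x => Ioi x

/-- The sign in front of the Volterra integral: `+ ∫_{-∞}^x` for `-`, and `- ∫_x^∞` for `+`. -/
def Side.sign : Side → ℂ
  | .minus => 1
  | .plus => -1

/-- The filter `x → -∞` or `x → +∞`. -/
def Side.toEnd : Side → Filter ℝ
  | .minus => atBot
  | .plus => atTop

def sigma1 : Matrix (Fin 2) (Fin 2) ℂ := !![0, 1; 1, 0]

def sigma3 : Matrix (Fin 2) (Fin 2) ℂ := !![1, 0; 0, -1]

/-- The matrix `σ_*`. -/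
def sigmaStar : Matrix (Fin 2) (Fin 2) ℂ := !![0, 1; -1, 0]

/-- Entrywise complex conjugation `A ↦ A^*` (no transposition). -/
def cconj (A : Matrix (Fin 2) (Fin 2) ℂ) : Matrix (Fin 2) (Fin 2) ℂ := A.map (starRingEnd ℂ)

/-- The matrix `e^{c σ₃}`. -/
def expSigma3 (c : ℂ) : Matrix (Fin 2) (Fin 2) ℂ :=
  !![Complex.exp c, 0; 0, Complex.exp (-c)]

/-- The matrix `Q` of the potential value `w`; `Q_±` is `Qmat u_±`. -/
def Qmat (w : ℂ) : Matrix (Fin 2) (Fin 2) ℂ := !![0, w; conj w, 0]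

/-- `k(z) = (z - u₀² / z) / (2α)`. -/
def kz (α u₀ : ℝ) (z : ℂ) : ℂ := (z - (u₀ : ℂ) ^ 2 / z) / (2 * (α : ℂ))

/-- `λ(z) = (z + u₀² / z) / 2`. -/
def lamz (u₀ : ℝ) (z : ℂ) : ℂ := (z + (u₀ : ℂ) ^ 2 / z) / 2

/-- `θ(x, t, z) = -k λ [x + (2 α k² - 4 α - u₀² / α) t]`. -/
def theta (α u₀ : ℝ) (x t : ℝ) (z : ℂ) : ℂ :=
  -(kz α u₀ z * lamz u₀ z) *
    ((x : ℂ) + (2 * (α : ℂ) * kz α u₀ z ^ 2 - 4 * (α : ℂ) - (u₀ : ℂ) ^ 2 / (α : ℂ)) * (t : ℂ))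

/-- `γ(z) = 1 + u₀² / z² = det Y_±`. -/
def gam (u₀ : ℝ) (z : ℂ) : ℂ := 1 + (u₀ : ℂ) ^ 2 / z ^ 2

/-- The eigenvector matrix `Y_± = I + z⁻¹ σ₃ Q_±`, where `w = u_±`. -/
def Ymat (w z : ℂ) : Matrix (Fin 2) (Fin 2) ℂ := 1 + z⁻¹ • (sigma3 * Qmat w)

/-- `ΔX_± = i k (Q - Q_±)` at a point where the potential has the value `v`, with `w = u_±`. -/
def DeltaX (α u₀ : ℝ) (z w v : ℂ) : Matrix (Fin 2) (Fin 2) ℂ :=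
  (Complex.I * kz α u₀ z) • (Qmat v - Qmat w)

/-- The `j`-th column of the Volterra integrand
`Y_± e^{-ikλ(x-y) σ₃} [Y_±⁻¹ ΔX_±(y) φ(y)] e^{ikλ(x-y) σ₃}`, where `f` is the `j`-th column of `φ`,
`w = u_±`, and `v` is the potential at a fixed time. -/
def volterraIntegrand (α u₀ : ℝ) (w : ℂ) (v : ℝ → ℂ) (z : ℂ) (j : Fin 2)
    (f : ℝ → Fin 2 → ℂ) (x y : ℝ) : Fin 2 → ℂ :=
  Complex.exp (Complex.I * kz α u₀ z * lamz u₀ z * ((x : ℂ) - (y : ℂ)) * sigma3 j j) •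
    ((Ymat w z * expSigma3 (-(Complex.I * kz α u₀ z * lamz u₀ z * ((x : ℂ) - (y : ℂ)))) *
      (Ymat w z)⁻¹ * DeltaX α u₀ z w (v y)) *ᵥ f y)

/-- `f` is the `j`-th column of the Jost solution `φ_±` at the spectral parameter `z`, for the
potential `v` (at a fixed time) and the limit value `w = u_±`: the Volterra integral converges
absolutely, `f` solves the Volterra integral equation, and `f` tends to the `j`-th column of `Y_±`
at the corresponding end of the line. -/
def IsJostColumn (α u₀ : ℝ) (w : ℂ) (s : Side) (v : ℝ → ℂ) (z : ℂ) (j : Fin 2)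
    (f : ℝ → Fin 2 → ℂ) : Prop :=
  (∀ x, IntegrableOn (volterraIntegrand α u₀ w v z j f x) (s.halfLine x)) ∧
  (∀ x, f x = (fun i => Ymat w z i j) +
    s.sign • ∫ y in s.halfLine x, volterraIntegrand α u₀ w v z j f x y) ∧
  Tendsto f s.toEnd (𝓝 (fun i => Ymat w z i j))

open Classical in
/-- The `j`-th column of `φ_±(·, t, z)`, where `w .minus = u_-` and `w .plus = u_+`: the unique function singled out by `IsJostColumn`.
(The value is `0` at those `z` for which there is no such function.) -/
def jostColumn (α u₀ : ℝ) (w : Side → ℂ) (s : Side) (u : ℝ → ℝ → ℂ) (t : ℝ) (z : ℂ) (j : Fin 2) :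
    ℝ → Fin 2 → ℂ :=
  if h : ∃! f, IsJostColumn α u₀ (w s) s (fun x => u x t) z j f then h.choose else 0

/-- The Jost solution `φ_±(x, t, z)` (normalised so that `φ_± → Y_±` as `x → ±∞`). -/
def jost (α u₀ : ℝ) (w : Side → ℂ) (s : Side) (u : ℝ → ℝ → ℂ) (x t : ℝ) (z : ℂ) :
    Matrix (Fin 2) (Fin 2) ℂ :=
  Matrix.of fun i j => jostColumn α u₀ w s u t z j x i

/-- The Jost solution `φ_± e^{iθσ₃}` of the original (not normalised) Lax pair. -/
def laxJost (α u₀ : ℝ) (w : Side → ℂ) (s : Side) (u : ℝ → ℝ → ℂ) (x t : ℝ) (z : ℂ) :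
    Matrix (Fin 2) (Fin 2) ℂ :=
  jost α u₀ w s u x t z * expSigma3 (Complex.I * theta α u₀ x t z)

/-- The set `D⁺ ∪ Σ` (without the origin being removed). -/
def closedDPlus : Set ℂ := {z | z.re * z.im ≤ 0}

/-- The set `D⁻ ∪ Σ` (without the origin being removed). -/
def closedDMinus : Set ℂ := {z | 0 ≤ z.re * z.im}

/-- The set `Σ = ℝ ∪ iℝ` (without the origin being removed). -/
def contour : Set ℂ := {z | z.re * z.im = 0}

/-- The region of the `z`-plane on which the `j`-th column of `φ_±` is defined: `D⁺ ∪ Σ` for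
`φ_{+,1}` and `φ_{-,2}`, and `D⁻ ∪ Σ` for `φ_{-,1}` and `φ_{+,2}`. -/
def columnDomain : Side → Fin 2 → Set ℂ
  | .plus, 0 => closedDPlus
  | .plus, 1 => closedDMinus
  | .minus, 0 => closedDMinus
  | .minus, 1 => closedDPlus

/-- The Wronskian `Wr(a, b) = det (a, b)` of column `i` of `A` and column `j` of `B`. -/
def wr (A : Matrix (Fin 2) (Fin 2) ℂ) (i : Fin 2) (B : Matrix (Fin 2) (Fin 2) ℂ) (j : Fin 2) : ℂ :=
  A 0 i * B 1 j - A 1 i * B 0 j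

/-- The scattering matrix of the potential `u(·, t)`, through the Wronskians of the Jost solutions
(taken at `x = 0`; they do not depend on `x`). -/
def scatteringMatrix (α u₀ : ℝ) (w : Side → ℂ) (u : ℝ → ℝ → ℂ) (t : ℝ) (z : ℂ) :
    Matrix (Fin 2) (Fin 2) ℂ :=
  let P := laxJost α u₀ w .plus u 0 t z
  let M := laxJost α u₀ w .minus u 0 t z
  (gam u₀ z)⁻¹ • !![wr P 0 M 1, wr P 1 M 1; wr M 0 P 0, wr M 0 P 1]

/-- The reflection coefficient `ρ = s₂₁ / s₁₁`. -/
def rho (α u₀ : ℝ) (w : Side → ℂ) (u : ℝ → ℝ → ℂ) (t : ℝ) (z : ℂ) : ℂ :=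
  scatteringMatrix α u₀ w u t z 1 0 / scatteringMatrix α u₀ w u t z 0 0

/-- The reflection coefficient `ρ̃ = s₁₂ / s₂₂`. -/
def rhoTilde (α u₀ : ℝ) (w : Side → ℂ) (u : ℝ → ℝ → ℂ) (t : ℝ) (z : ℂ) : ℂ :=
  scatteringMatrix α u₀ w u t z 0 1 / scatteringMatrix α u₀ w u t z 1 1

end

end MNLS

open MNLS

/-!
After the reflection `x ↦ ±x`, the integral equation for a column of `φ_±` becomes a Volterra
equation `f(x) = c + ∫_x^∞ e^{(x-y)A} V(y) f(y) dy`, in which `e^{sA}` is bounded for `s ≤ 0`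
because `z` lies in the closed region attached to that column, and `V = ΔX_±` (up to sign) is
integrable. In the sup norm weighted by `exp ∫_x^∞ 2C‖V‖` the integral operator is a contraction,
which gives existence and uniqueness.

Each symmetry maps the integral equation of one column at `z` to that of a column at `z^*`, `-z^*`
or `-u₀² / z`, by an invertible real-linear map of `ℂ²` that matches the normalisations; uniqueness
turns this into a symmetry of the Jost solutions, hence of their Wronskians, which are the entries
of `S`. The symmetries `z ↦ z^*` and `z ↦ -z^*` compose to the parity of `S`.

In the original Lax pair both Jost solutions solve the same linear equation with traceless
coefficients, so all their Wronskians are constant in `x`. Letting `x → ±∞` identifies `det φ_±`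
with `γ ≠ 0`, and `S = φ_-⁻¹ φ_+` is constant in `x`.
-/

namespace MNLS

noncomputable section

section TailIntegral

variable {E : Type*} [NormedAddCommGroup E] [NormedSpace ℝ E] {h : ℝ → E}

theorem integral_Ioi_eq_sub (hh : ∀ x, IntegrableOn h (Ioi x)) (x : ℝ) :
    ∫ y in Ioi x, h y = (∫ y in Ioi 0, h y) - ∫ y in (0 : ℝ)..x, h y := by
  rw [← intervalIntegral.integral_Ioi_sub_Ioi' (hh 0) (hh x), sub_sub_cancel]

theorem continuous_integral_Ioi (hh : ∀ x, IntegrableOn h (Ioi x)) :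
    Continuous fun x => ∫ y in Ioi x, h y := by
  rw [funext (integral_Ioi_eq_sub hh)]
  exact continuous_const.sub (intervalIntegral.continuous_primitive (fun a b =>
    ⟨(hh a).mono_set Ioc_subset_Ioi_self, (hh b).mono_set Ioc_subset_Ioi_self⟩) 0)

theorem hasDerivAt_integral_Ioi [CompleteSpace E] (hh : ∀ x, IntegrableOn h (Ioi x))
    (hc : Continuous h) (x : ℝ) : HasDerivAt (fun x => ∫ y in Ioi x, h y) (-h x) x := by
  rw [funext (integral_Ioi_eq_sub hh)]
  exact (hc.integral_hasStrictDerivAt 0 x).hasDerivAt.const_sub _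

end TailIntegral

section TailExp

/-- The weight `exp ∫_x^∞ q`. In the norm weighted by it, integration over `(x, ∞)` against `q / 2`
contracts by a factor `1 / 2`. -/
def tailExp (q : ℝ → ℝ) (x : ℝ) : ℝ := Real.exp (∫ y in Ioi x, q y)

variable {q : ℝ → ℝ}

theorem tailExp_pos (q : ℝ → ℝ) (x : ℝ) : 0 < tailExp q x := Real.exp_pos _

theorem one_le_tailExp (hq₀ : ∀ x, 0 ≤ q x) (x : ℝ) : 1 ≤ tailExp q x :=
  Real.one_le_exp (integral_nonneg hq₀)

theorem continuous_tailExp (hi : ∀ x, IntegrableOn q (Ioi x)) : Continuous (tailExp q) :=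
  Real.continuous_exp.comp (continuous_integral_Ioi hi)

theorem tendsto_tailExp (q : ℝ → ℝ) : Tendsto (tailExp q) atTop (𝓝 1) := by
  rw [← Real.exp_zero]
  exact (Real.continuous_exp.tendsto 0).comp (tendsto_integral_Ioi_zero tendsto_id)

theorem hasDerivAt_tailExp (hq : Continuous q) (hi : ∀ x, IntegrableOn q (Ioi x)) (x : ℝ) :
    HasDerivAt (tailExp q) (-(q x * tailExp q x)) x := by
  convert! (hasDerivAt_integral_Ioi hi hq x).exp using 1
  rw [tailExp]
  ring

variable (hq : Continuous q) (hq₀ : ∀ x, 0 ≤ q x) (hi : ∀ x, IntegrableOn q (Ioi x))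
include hq hq₀ hi

theorem integrableOn_mul_tailExp (x : ℝ) :
    IntegrableOn (fun y => q y * tailExp q y) (Ioi x) := by
  simpa using (integrableOn_Ioi_deriv_of_nonpos' (fun y _ => hasDerivAt_tailExp hq hi y)
    (fun y _ => neg_nonpos.2 (mul_nonneg (hq₀ y) (tailExp_pos q y).le)) (tendsto_tailExp q)).neg

theorem integral_mul_tailExp (x : ℝ) : ∫ y in Ioi x, q y * tailExp q y = tailExp q x - 1 := by
  rw [← neg_inj, ← integral_neg, neg_sub]
  exact integral_Ioi_of_hasDerivAt_of_nonpos' (fun y _ => hasDerivAt_tailExp hq hi y)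
    (fun y _ => neg_nonpos.2 (mul_nonneg (hq₀ y) (tailExp_pos q y).le)) (tendsto_tailExp q)

end TailExp

section TailDuhamel

open NormedSpace (exp)

variable {E : Type*} [NormedAddCommGroup E] [NormedSpace ℝ E] {A : E →L[ℝ] E} {h g : ℝ → E}

/-- The Duhamel integral from `+∞` of the source `h` for the linear equation `f' = A f - h`. -/
def tailDuhamel (A : E →L[ℝ] E) (h : ℝ → E) (x : ℝ) : E :=
  ∫ y in Ioi x, exp ((x - y) • A) (h y)

theorem tailDuhamel_sub (hh : ∀ x, IntegrableOn (fun y => exp ((x - y) • A) (h y)) (Ioi x))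
    (hg : ∀ x, IntegrableOn (fun y => exp ((x - y) • A) (g y)) (Ioi x)) (x : ℝ) :
    tailDuhamel A (fun y => h y - g y) x = tailDuhamel A h x - tailDuhamel A g x := by
  simp only [tailDuhamel, map_sub]
  exact integral_sub (hh x) (hg x)

variable [CompleteSpace E]

theorem continuous_exp_smul (A : E →L[ℝ] E) : Continuous fun s : ℝ => exp (s • A) :=
  continuous_iff_continuousAt.2 fun s => (hasDerivAt_exp_smul_const A s).continuousAt

theorem exp_add_smul_apply (A : E →L[ℝ] E) (s r : ℝ) (v : E) :
    exp ((s + r) • A) v = exp (s • A) (exp (r • A) v) := by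
  let _ : NormedAlgebra ℚ (E →L[ℝ] E) := .restrictScalars ℚ ℝ _
  rw [add_smul, NormedSpace.exp_add_of_commute (((Commute.refl A).smul_left s).smul_right r),
    mul_apply_eq_comp]

variable (hh : ∀ x, IntegrableOn (fun y => exp ((x - y) • A) (h y)) (Ioi x))
include hh

theorem integrableOn_exp_neg_smul (x : ℝ) :
    IntegrableOn (fun y => exp (-y • A) (h y)) (Ioi x) := by
  refine ((exp (-x • A)).integrable_comp (hh x)).congr (.of_forall fun y => ?_)
  simp only [← exp_add_smul_apply, neg_add_cancel_left, sub_eq_add_neg]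

theorem tailDuhamel_eq_exp_apply (x : ℝ) :
    tailDuhamel A h x =
      exp (x • A) (∫ y in Ioi x, exp (-y • A) (h y)) := by
  rw [← ContinuousLinearMap.integral_comp_comm _ (integrableOn_exp_neg_smul hh x)]
  simp only [tailDuhamel, ← exp_add_smul_apply, sub_eq_add_neg]

theorem continuous_tailDuhamel : Continuous (tailDuhamel A h) := by
  rw [funext (tailDuhamel_eq_exp_apply hh)]
  exact (continuous_exp_smul A).clm_apply (continuous_integral_Ioi (integrableOn_exp_neg_smul hh))

theorem hasDerivAt_tailDuhamel (hc : Continuous h) (x : ℝ) :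
    HasDerivAt (tailDuhamel A h) (A (tailDuhamel A h x) - h x) x := by
  have hc' : Continuous fun y => exp (-y • A) (h y) :=
    ((continuous_exp_smul A).comp continuous_neg).clm_apply hc
  rw [funext (tailDuhamel_eq_exp_apply hh)]
  convert! (hasDerivAt_exp_smul_const' A x).clm_apply
    (hasDerivAt_integral_Ioi (integrableOn_exp_neg_smul hh) hc' x) using 1
  rw [map_neg, ← exp_add_smul_apply, add_neg_cancel, zero_smul, NormedSpace.exp_zero,
    one_apply_eq_self, mul_apply_eq_comp, sub_eq_add_neg]

end TailDuhamel

section TailVolterra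

open NormedSpace (exp)
open scoped BoundedContinuousFunction

variable {E : Type*} [NormedAddCommGroup E] [NormedSpace ℝ E] {A : E →L[ℝ] E}
  {V : ℝ → E →L[ℝ] E} {C : ℝ} {c : E} {f g : ℝ → E}

/-- `f` solves the Volterra equation `f(x) = c + ∫_x^∞ e^{(x-y)A} V(y) f(y) dy`, with absolutely
convergent integrals, and tends to `c` at `+∞`. -/
structure IsTailSolution (A : E →L[ℝ] E) (V : ℝ → E →L[ℝ] E) (c : E) (f : ℝ → E) : Prop where
  integrableOn : ∀ x, IntegrableOn (fun y => exp ((x - y) • A) (V y (f y))) (Ioi x)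
  eq_add : ∀ x, f x = c + tailDuhamel A (fun y => V y (f y)) x
  tendsto : Tendsto f atTop (𝓝 c)

/-- The Volterra equation with generator `A` and perturbation `V` is well posed at `+∞`: the
semigroup `e^{sA}`, `s ≤ 0`, is bounded by `C` and `V` is continuous and integrable at `+∞`. -/
structure IsTailAdmissible (A : E →L[ℝ] E) (V : ℝ → E →L[ℝ] E) (C : ℝ) : Prop where
  norm_exp_le : ∀ s : ℝ, s ≤ 0 → ‖exp (s • A)‖ ≤ C
  continuous : Continuous V
  integrableOn : ∀ x, IntegrableOn V (Ioi x)

/-- The weight in whose sup norm the Volterra operator contracts by a factor `1 / 2`. -/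
def volterraWeight (V : ℝ → E →L[ℝ] E) (C : ℝ) : ℝ → ℝ := tailExp fun y => 2 * C * ‖V y‖

theorem volterraWeight_pos (V : ℝ → E →L[ℝ] E) (C x : ℝ) : 0 < volterraWeight V C x :=
  tailExp_pos _ x

theorem tendsto_volterraWeight (V : ℝ → E →L[ℝ] E) (C : ℝ) :
    Tendsto (volterraWeight V C) atTop (𝓝 1) := tendsto_tailExp _

theorem norm_volterraWeight_smul_le (g : ℝ →ᵇ E) (y : ℝ) :
    ‖volterraWeight V C y • g y‖ ≤ ‖g‖ * volterraWeight V C y := by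
  rw [norm_smul, Real.norm_of_nonneg (volterraWeight_pos V C y).le, mul_comm]
  exact mul_le_mul_of_nonneg_right (g.norm_coe_le_norm y) (volterraWeight_pos V C y).le

namespace IsTailAdmissible

variable (hV : IsTailAdmissible A V C)
include hV

theorem rate_nonneg (y : ℝ) : 0 ≤ 2 * C * ‖V y‖ :=
  have hC : 0 ≤ C := (norm_nonneg _).trans (hV.norm_exp_le 0 le_rfl)
  by positivity

theorem integrableOn_rate (x : ℝ) : IntegrableOn (fun y => 2 * C * ‖V y‖) (Ioi x) :=
  (hV.integrableOn x).norm.const_mul _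

theorem one_le_weight (x : ℝ) : 1 ≤ volterraWeight V C x := one_le_tailExp hV.rate_nonneg x

theorem continuous_weight : Continuous (volterraWeight V C) :=
  continuous_tailExp hV.integrableOn_rate

theorem norm_integrand_le {M x y : ℝ} (hxy : x < y) (hf : ‖f y‖ ≤ M * volterraWeight V C y) :
    ‖exp ((x - y) • A) (V y (f y))‖ ≤ M / 2 * (2 * C * ‖V y‖ * volterraWeight V C y) := by
  have hexp := hV.norm_exp_le (x - y) (sub_nonpos.2 hxy.le)
  have hVf : ‖V y (f y)‖ ≤ ‖V y‖ * (M * volterraWeight V C y) :=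
    (V y).le_of_opNorm_le_of_le le_rfl hf
  calc ‖exp ((x - y) • A) (V y (f y))‖ ≤ C * (‖V y‖ * (M * volterraWeight V C y)) :=
        ContinuousLinearMap.le_of_opNorm_le_of_le _ hexp hVf
    _ = M / 2 * (2 * C * ‖V y‖ * volterraWeight V C y) := by ring

theorem integrableOn_rate_mul_weight (x : ℝ) :
    IntegrableOn (fun y => 2 * C * ‖V y‖ * volterraWeight V C y) (Ioi x) :=
  integrableOn_mul_tailExp (continuous_const.mul hV.continuous.norm) hV.rate_nonneg
    hV.integrableOn_rate x

theorem norm_tailDuhamel_le {M x : ℝ} (hf : ∀ y, x ≤ y → ‖f y‖ ≤ M * volterraWeight V C y) :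
    ‖tailDuhamel A (fun y => V y (f y)) x‖ ≤ M / 2 * (volterraWeight V C x - 1) := by
  have hle : ∀ y ∈ Ioi x, ‖exp ((x - y) • A) (V y (f y))‖ ≤
      M / 2 * (2 * C * ‖V y‖ * volterraWeight V C y) :=
    fun y hy => hV.norm_integrand_le hy (hf y hy.le)
  refine (norm_integral_le_of_norm_le ((hV.integrableOn_rate_mul_weight x).const_mul (M / 2))
    (ae_restrict_of_forall_mem measurableSet_Ioi hle)).trans_eq ?_
  rw [integral_const_mul]
  exact congrArg _ (integral_mul_tailExp (continuous_const.mul hV.continuous.norm) hV.rate_nonneg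
    hV.integrableOn_rate x)

theorem eq_zero_of_eq_tailDuhamel {M x : ℝ} (hM : ∀ y, x ≤ y → ‖f y‖ ≤ M)
    (hf : ∀ y, f y = tailDuhamel A (fun y => V y (f y)) y) : f x = 0 := by
  have hM₀ : 0 ≤ M := (norm_nonneg _).trans (hM x le_rfl)
  have hbound (n : ℕ) : ∀ y, x ≤ y → ‖f y‖ ≤ M * (1 / 2) ^ n * volterraWeight V C y := by
    induction n with
    | zero =>
      intro y hxy
      simpa using (hM y hxy).trans (le_mul_of_one_le_right hM₀ (hV.one_le_weight y))
    | succ n ih =>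
      intro y hxy
      calc ‖f y‖ = ‖tailDuhamel A (fun y => V y (f y)) y‖ := by rw [← hf y]
        _ ≤ M * (1 / 2) ^ n / 2 * (volterraWeight V C y - 1) :=
          hV.norm_tailDuhamel_le fun y' hy' => ih y' (hxy.trans hy')
        _ ≤ M * (1 / 2) ^ n / 2 * volterraWeight V C y := by gcongr; linarith
        _ = M * (1 / 2) ^ (n + 1) * volterraWeight V C y := by ring
  have hlim : Tendsto (fun n : ℕ => M * (1 / 2 : ℝ) ^ n * volterraWeight V C x) atTop (𝓝 0) := by
    simpa using ((tendsto_pow_atTop_nhds_zero_of_lt_one (r := (1 / 2 : ℝ)) (by norm_num)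
      (by norm_num)).const_mul M).mul_const (volterraWeight V C x)
  exact norm_le_zero_iff.1 (ge_of_tendsto' hlim fun n => hbound n x le_rfl)

theorem continuous_weight_smul (g : ℝ →ᵇ E) : Continuous fun y => volterraWeight V C y • g y :=
  hV.continuous_weight.smul g.continuous

theorem norm_tailDuhamel_weight_smul_le (g : ℝ →ᵇ E) (x : ℝ) :
    ‖tailDuhamel A (fun y => V y (volterraWeight V C y • g y)) x‖ ≤
      ‖g‖ / 2 * (volterraWeight V C x - 1) :=
  hV.norm_tailDuhamel_le fun y _ => norm_volterraWeight_smul_le g y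

theorem norm_weight_inv_smul_le (g : ℝ →ᵇ E) (x : ℝ) :
    ‖(volterraWeight V C x)⁻¹ • (c + tailDuhamel A (fun y => V y (volterraWeight V C y • g y)) x)‖ ≤
      ‖c‖ + ‖g‖ / 2 := by
  rw [norm_smul, norm_inv, Real.norm_of_nonneg (volterraWeight_pos V C x).le,
    inv_mul_le_iff₀ (volterraWeight_pos V C x)]
  have hW := hV.one_le_weight x
  calc _ ≤ ‖c‖ + ‖g‖ / 2 * (volterraWeight V C x - 1) :=
        norm_add_le_of_le le_rfl (hV.norm_tailDuhamel_weight_smul_le g x)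
    _ ≤ volterraWeight V C x * (‖c‖ + ‖g‖ / 2) := by nlinarith [norm_nonneg c, norm_nonneg g]

variable [CompleteSpace E]

theorem integrableOn_exp_smul_apply {M : ℝ} (hc : Continuous f)
    (hf : ∀ y, ‖f y‖ ≤ M * volterraWeight V C y) (x : ℝ) :
    IntegrableOn (fun y => exp ((x - y) • A) (V y (f y))) (Ioi x) :=
  Integrable.mono' ((hV.integrableOn_rate_mul_weight x).const_mul (M / 2))
    (((continuous_exp_smul A).comp (continuous_const.sub continuous_id)).clm_apply
      (hV.continuous.clm_apply hc)).aestronglyMeasurable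
    (ae_restrict_of_forall_mem measurableSet_Ioi fun y hy => hV.norm_integrand_le hy (hf y))

end IsTailAdmissible

namespace IsTailSolution

theorem sub_eq_tailDuhamel (hf : IsTailSolution A V c f) (hg : IsTailSolution A V c g) (x : ℝ) :
    f x - g x = tailDuhamel A (fun y => V y (f y - g y)) x := by
  simp only [map_sub]
  rw [tailDuhamel_sub hf.integrableOn hg.integrableOn, hf.eq_add x, hg.eq_add x,
    add_sub_add_left_eq_sub]

variable [CompleteSpace E]

theorem continuous (hf : IsTailSolution A V c f) : Continuous f := by
  rw [funext hf.eq_add]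
  exact continuous_const.add (continuous_tailDuhamel hf.integrableOn)

theorem hasDerivAt (hf : IsTailSolution A V c f) (hV : Continuous V) (x : ℝ) :
    HasDerivAt f (A (f x - c) - V x (f x)) x := by
  have hderiv := (hasDerivAt_tailDuhamel hf.integrableOn (hV.clm_apply hf.continuous) x).const_add c
  rw [hf.eq_add x, add_sub_cancel_left, ← hf.eq_add x]
  exact hderiv.congr_of_eventuallyEq (.of_forall hf.eq_add)

theorem exists_norm_le (hf : IsTailSolution A V c f) (x : ℝ) : ∃ M, ∀ y, x ≤ y → ‖f y‖ ≤ M := by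
  obtain ⟨a, ha⟩ := eventually_atTop.1 (hf.tendsto.norm.eventually_le_const (lt_add_one ‖c‖))
  obtain ⟨M, hM⟩ := (isCompact_Icc (a := x) (b := a)).exists_bound_of_continuousOn
    hf.continuous.continuousOn
  refine ⟨max M (‖c‖ + 1), fun y hxy => ?_⟩
  rcases le_total y a with hya | hay
  · exact (hM y ⟨hxy, hya⟩).trans (le_max_left _ _)
  · exact (ha y hay).trans (le_max_right _ _)

end IsTailSolution

namespace IsTailAdmissible

variable (hV : IsTailAdmissible A V C)
include hV

variable [CompleteSpace E]

theorem isTailSolution_unique (hf : IsTailSolution A V c f) (hg : IsTailSolution A V c g) :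
    f = g := by
  funext x
  obtain ⟨M, hM⟩ := hf.exists_norm_le x
  obtain ⟨M', hM'⟩ := hg.exists_norm_le x
  exact sub_eq_zero.1 (hV.eq_zero_of_eq_tailDuhamel (f := fun y => f y - g y)
    (fun y hy => norm_sub_le_of_le (hM y hy) (hM' y hy)) (hf.sub_eq_tailDuhamel hg))

theorem integrableOn_weight_smul (g : ℝ →ᵇ E) (x : ℝ) :
    IntegrableOn (fun y => exp ((x - y) • A) (V y (volterraWeight V C y • g y)))
      (Ioi x) :=
  hV.integrableOn_exp_smul_apply (hV.continuous_weight_smul g) (norm_volterraWeight_smul_le g) x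

/-- The map whose fixed points `g` give the solutions `volterraWeight V C • g` of the Volterra
equation. -/
def volterraMap (c : E) (g : ℝ →ᵇ E) : ℝ →ᵇ E :=
  .ofNormedAddCommGroup
    (fun x => (volterraWeight V C x)⁻¹ •
      (c + tailDuhamel A (fun y => V y (volterraWeight V C y • g y)) x))
    ((hV.continuous_weight.inv₀ fun x => (volterraWeight_pos V C x).ne').smul
      (continuous_const.add (continuous_tailDuhamel (hV.integrableOn_weight_smul g))))
    (‖c‖ + ‖g‖ / 2) (hV.norm_weight_inv_smul_le g)

theorem weight_smul_volterraMap_apply (c : E) (g : ℝ →ᵇ E) (x : ℝ) :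
    volterraWeight V C x • hV.volterraMap c g x =
      c + tailDuhamel A (fun y => V y (volterraWeight V C y • g y)) x :=
  smul_inv_smul₀ (volterraWeight_pos V C x).ne' _

theorem weight_smul_volterraMap_sub (c : E) (g₁ g₂ : ℝ →ᵇ E) (x : ℝ) :
    volterraWeight V C x • (hV.volterraMap c g₁ x - hV.volterraMap c g₂ x) =
      tailDuhamel A (fun y => V y (volterraWeight V C y • (g₁ - g₂) y)) x := by
  simp only [BoundedContinuousFunction.coe_sub, Pi.sub_apply, smul_sub, map_sub]
  rw [tailDuhamel_sub (hV.integrableOn_weight_smul g₁) (hV.integrableOn_weight_smul g₂),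
    hV.weight_smul_volterraMap_apply, hV.weight_smul_volterraMap_apply, add_sub_add_left_eq_sub]

theorem contractingWith_volterraMap (c : E) : ContractingWith (1 / 2) (hV.volterraMap c) := by
  refine ⟨by rw [← NNReal.coe_lt_coe]; norm_num, LipschitzWith.of_dist_le_mul fun g₁ g₂ => ?_⟩
  refine (BoundedContinuousFunction.dist_le (by positivity)).2 fun x => ?_
  have hle := hV.norm_tailDuhamel_weight_smul_le (g₁ - g₂) x
  rw [← hV.weight_smul_volterraMap_sub c, norm_smul,
    Real.norm_of_nonneg (volterraWeight_pos V C x).le] at hle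
  rw [dist_eq_norm, dist_eq_norm, ← mul_le_mul_iff_right₀ (volterraWeight_pos V C x)]
  push_cast
  nlinarith [norm_nonneg (g₁ - g₂), hV.one_le_weight x]

theorem exists_isTailSolution (c : E) : ∃ f, IsTailSolution A V c f := by
  have hcontr := hV.contractingWith_volterraMap c
  set g := ContractingWith.fixedPoint _ hcontr
  have hsol (x : ℝ) : volterraWeight V C x • g x =
      c + tailDuhamel A (fun y => V y (volterraWeight V C y • g y)) x := by
    rw [← hV.weight_smul_volterraMap_apply, hcontr.fixedPoint_isFixedPt]
  refine ⟨fun x => volterraWeight V C x • g x, hV.integrableOn_weight_smul g, hsol, ?_⟩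
  rw [tendsto_iff_norm_sub_tendsto_zero]
  refine squeeze_zero (fun _ => norm_nonneg _) (fun x => ?_)
    (show Tendsto (fun x => ‖g‖ / 2 * (volterraWeight V C x - 1)) atTop (𝓝 0) from ?_)
  · rw [hsol x, add_sub_cancel_left]
    exact hV.norm_tailDuhamel_weight_smul_le g x
  · simpa using ((tendsto_volterraWeight V C).sub_const 1).const_mul (‖g‖ / 2)

theorem existsUnique_isTailSolution (c : E) : ∃! f, IsTailSolution A V c f :=
  existsUnique_of_exists_of_unique (hV.exists_isTailSolution c) fun _ _ => hV.isTailSolution_unique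

end IsTailAdmissible

end TailVolterra

section MulVec

variable {n : Type*} [Fintype n] [DecidableEq n]

/-- Left multiplication by a complex matrix, as a real-linear operator with the sup norm. -/
def mulVecCLM : Matrix n n ℂ →ₐ[ℝ] ((n → ℂ) →L[ℝ] (n → ℂ)) where
  toFun A := (A.mulVecLin.restrictScalars ℝ).toContinuousLinearMap
  map_one' := by ext v : 1; exact one_mulVec v
  map_mul' A B := by ext v : 1; exact (mulVec_mulVec v A B).symm
  map_zero' := by ext v : 1; exact zero_mulVec v
  map_add' A B := by ext v : 1; exact add_mulVec A B v
  commutes' r := by ext v : 1; simp [Algebra.algebraMap_eq_smul_one]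

theorem mulVecCLM_apply (A : Matrix n n ℂ) (v : n → ℂ) : mulVecCLM A v = A *ᵥ v := rfl

open scoped Matrix.Norms.Operator in
theorem mulVecCLM_exp (A : Matrix n n ℂ) :
    mulVecCLM (NormedSpace.exp A) = NormedSpace.exp (mulVecCLM A) := by
  let _ : NormedAlgebra ℚ ((n → ℂ) →L[ℝ] (n → ℂ)) := .restrictScalars ℚ ℝ _
  exact NormedSpace.map_exp mulVecCLM
    (mulVecCLM (n := n)).toLinearMap.continuous_of_finiteDimensional A

theorem norm_mulVecCLM_diagonal_le {d : n → ℂ} (hd : ∀ i, ‖d i‖ ≤ 1) :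
    ‖mulVecCLM (diagonal d)‖ ≤ 1 := by
  refine ContinuousLinearMap.opNorm_le_bound _ zero_le_one fun v => ?_
  rw [mulVecCLM_apply, one_mul]
  refine (pi_norm_le_iff_of_nonneg (norm_nonneg v)).2 fun i => ?_
  rw [mulVec_diagonal, norm_mul]
  exact (mul_le_of_le_one_left (norm_nonneg _) (hd i)).trans (norm_le_pi_norm v i)

end MulVec

namespace Side

/-- The direction `±1` of the given end of the line. -/
def dir : Side → ℝ
  | .minus => -1
  | .plus => 1

theorem sign_smul {E : Type*} [AddCommGroup E] [Module ℂ E] [Module ℝ E] [IsScalarTower ℝ ℂ E]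
    (s : Side) (v : E) : s.sign • v = -s.dir • v := by
  cases s <;> simp [sign, dir]

theorem dir_mul_dir_mul (s : Side) (x : ℝ) : s.dir * (s.dir * x) = x := by
  cases s <;> simp [dir]

theorem dir_ne_zero (s : Side) : s.dir ≠ 0 := by cases s <;> simp [dir]

theorem continuous_dir_mul (s : Side) : Continuous fun x => s.dir * x := by fun_prop

theorem forall_dir_mul (s : Side) {p : ℝ → Prop} : (∀ x, p x) ↔ ∀ x, p (s.dir * x) :=
  (mul_left_surjective₀ s.dir_ne_zero).forall

theorem tendsto_toEnd_iff {X : Type*} (s : Side) {f : ℝ → X} {l : Filter X} :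
    Tendsto f s.toEnd l ↔ Tendsto (fun x => f (s.dir * x)) atTop l := by
  cases s with
  | minus => simp [toEnd, dir, ← tendsto_comp_neg_atTop_iff]
  | plus => simp [toEnd, dir]

instance neBot_toEnd (s : Side) : s.toEnd.NeBot := by
  cases s <;> simp only [toEnd] <;> infer_instance

variable {E : Type*} [NormedAddCommGroup E]

theorem integrableOn_halfLine_iff (s : Side) {g : ℝ → E} {x : ℝ} :
    IntegrableOn g (s.halfLine (s.dir * x)) ↔ IntegrableOn (fun y => g (s.dir * y)) (Ioi x) := by
  cases s with
  | minus =>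
    rw [← integrableOn_Ici_iff_integrableOn_Ioi, halfLine, ← (Measure.measurePreserving_neg
      (volume : Measure ℝ)).integrableOn_comp_preimage
      (MeasurableEquiv.neg ℝ).measurableEmbedding]
    simp [dir, Function.comp_def]
  | plus => simp [halfLine, dir]

theorem setIntegral_halfLine [NormedSpace ℝ E] (s : Side) (g : ℝ → E) (x : ℝ) :
    ∫ y in s.halfLine (s.dir * x), g y = ∫ y in Ioi x, g (s.dir * y) := by
  cases s with
  | minus => simp [halfLine, dir, integral_comp_neg_Ioi]
  | plus => simp [halfLine, dir]

end Side

section SpectralData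

theorem mul_conj_eq_sq {u₀ : ℝ} {w : ℂ} (hw : ‖w‖ = u₀) : w * conj w = (u₀ : ℂ) ^ 2 := by
  rw [Complex.mul_conj', hw]

theorem Ymat_eq (w z : ℂ) : Ymat w z = !![1, w / z; -(conj w / z), 1] := by
  ext i j
  fin_cases i <;> fin_cases j <;> simp [Ymat, sigma3, Qmat, div_eq_inv_mul]

theorem gam_ne_zero {u₀ : ℝ} {z : ℂ} (hz : z ≠ 0) (hz' : z ^ 2 ≠ -(u₀ : ℂ) ^ 2) :
    gam u₀ z ≠ 0 := by
  contrapose! hz'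
  rw [gam] at hz'
  field_simp at hz'
  exact eq_neg_of_add_eq_zero_left (by simpa using hz')

theorem det_Ymat {u₀ : ℝ} {w : ℂ} (hw : ‖w‖ = u₀) (z : ℂ) : (Ymat w z).det = gam u₀ z := by
  rw [Ymat_eq, det_fin_two_of, gam, ← mul_conj_eq_sq hw]
  ring

theorem isUnit_Ymat {u₀ : ℝ} {w z : ℂ} (hw : ‖w‖ = u₀) (hγ : gam u₀ z ≠ 0) :
    IsUnit (Ymat w z) := by
  rwa [isUnit_iff_isUnit_det, det_Ymat hw, isUnit_iff_ne_zero]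

/-- The eigenvalue `a = ikλ` for which the columns of `Y_± e^{-axσ₃}` solve the Lax equation with
constant potential `u_±`. -/
def laxEigenvalue (α u₀ : ℝ) (z : ℂ) : ℂ := Complex.I * kz α u₀ z * lamz u₀ z

/-- The coefficient matrix `X = -iαk²σ₃ + ikQ` of the equation in `x` of the Lax pair, at a point
where the potential has the value `v`. -/
def laxX (α u₀ : ℝ) (z v : ℂ) : Matrix (Fin 2) (Fin 2) ℂ :=
  (Complex.I * kz α u₀ z) • (Qmat v - (α * kz α u₀ z) • sigma3)

/-- The coefficient matrix of the equation in `x` satisfied by the `j`-th column of `φ_±`. -/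
def jostX (α u₀ : ℝ) (z : ℂ) (j : Fin 2) (v : ℂ) : Matrix (Fin 2) (Fin 2) ℂ :=
  (laxEigenvalue α u₀ z * sigma3 j j) • 1 + laxX α u₀ z v

theorem jostX_add_DeltaX (α u₀ : ℝ) (z w v : ℂ) (j : Fin 2) :
    jostX α u₀ z j w + DeltaX α u₀ z w v = jostX α u₀ z j v := by
  simp only [jostX, laxX, DeltaX]
  module

variable {α u₀ : ℝ} {w z : ℂ}

theorem laxX_mul_Ymat (hα : α ≠ 0) (hz : z ≠ 0) (hw : ‖w‖ = u₀) :
    laxX α u₀ z w * Ymat w z = -laxEigenvalue α u₀ z • (Ymat w z * sigma3) := by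
  have hα' : (α : ℂ) ≠ 0 := Complex.ofReal_ne_zero.2 hα
  have hQ : (Qmat w - (α * kz α u₀ z) • sigma3) * Ymat w z =
      -lamz u₀ z • (Ymat w z * sigma3) := by
    rw [Ymat_eq]
    ext i j
    fin_cases i <;> fin_cases j <;>
      simp [Qmat, sigma3, kz, lamz, ← mul_conj_eq_sq hw] <;> field_simp <;> ring
  rw [laxX, smul_mul_assoc, hQ, smul_smul, laxEigenvalue, mul_neg]

theorem jostX_mul_Ymat (hα : α ≠ 0) (hz : z ≠ 0) (hw : ‖w‖ = u₀) (j : Fin 2) :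
    jostX α u₀ z j w * Ymat w z =
      Ymat w z * diagonal fun i => laxEigenvalue α u₀ z * (sigma3 j j - sigma3 i i) := by
  rw [jostX, add_mul, laxX_mul_Ymat hα hz hw]
  ext i k
  fin_cases k <;> simp [sigma3, mul_apply] <;> ring

theorem jostX_mulVec_col (hα : α ≠ 0) (hz : z ≠ 0) (hw : ‖w‖ = u₀) (j : Fin 2) :
    jostX α u₀ z j w *ᵥ (Ymat w z).col j = 0 := by
  ext i
  rw [← mulVec_single_one, mulVec_mulVec, jostX_mul_Ymat hα hz hw, mulVec_single_one, col_apply,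
    mul_diagonal, sub_self, mul_zero, mul_zero, Pi.zero_apply]

theorem exp_smul_jostX (hα : α ≠ 0) (hz : z ≠ 0) (hw : ‖w‖ = u₀) (hγ : gam u₀ z ≠ 0) (j : Fin 2)
    (r : ℝ) :
    NormedSpace.exp (r • jostX α u₀ z j w) = Ymat w z * diagonal (fun i =>
      Complex.exp (r * (laxEigenvalue α u₀ z * (sigma3 j j - sigma3 i i)))) * (Ymat w z)⁻¹ := by
  have hY := isUnit_Ymat hw hγ
  have hconj : r • jostX α u₀ z j w = Ymat w z * diagonal (fun i =>
      r * (laxEigenvalue α u₀ z * (sigma3 j j - sigma3 i i))) * (Ymat w z)⁻¹ := by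
    rw [← mul_nonsing_inv_cancel_right _ (jostX α u₀ z j w) ((isUnit_iff_isUnit_det _).1 hY),
      jostX_mul_Ymat hα hz hw, ← smul_mul_assoc, ← mul_smul_comm, ← diagonal_smul]
    rfl
  rw [hconj, exp_conj _ _ hY, exp_diagonal]
  congr
  ext i
  rw [Pi.coe_exp, Complex.exp_eq_exp_ℂ]

theorem volterraIntegrand_eq (α u₀ : ℝ) (w : ℂ) (v : ℝ → ℂ) (z : ℂ) (j : Fin 2)
    (f : ℝ → Fin 2 → ℂ) (x y : ℝ) :
    volterraIntegrand α u₀ w v z j f x y =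
      Complex.exp (laxEigenvalue α u₀ z * ((x : ℂ) - y) * sigma3 j j) •
        ((Ymat w z * expSigma3 (-(laxEigenvalue α u₀ z * ((x : ℂ) - y))) * (Ymat w z)⁻¹ *
          DeltaX α u₀ z w (v y)) *ᵥ f y) := rfl

theorem volterraIntegrand_eq_exp_mulVec (hα : α ≠ 0) (hz : z ≠ 0) (hw : ‖w‖ = u₀)
    (hγ : gam u₀ z ≠ 0) (v : ℝ → ℂ) (j : Fin 2) (f : ℝ → Fin 2 → ℂ) (x y : ℝ) :
    volterraIntegrand α u₀ w v z j f x y =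
      NormedSpace.exp ((x - y) • jostX α u₀ z j w) *ᵥ (DeltaX α u₀ z w (v y) *ᵥ f y) := by
  have hdiag : Complex.exp (laxEigenvalue α u₀ z * ((x : ℂ) - y) * sigma3 j j) •
      expSigma3 (-(laxEigenvalue α u₀ z * ((x : ℂ) - y))) = diagonal fun i =>
        Complex.exp ((x - y : ℝ) * (laxEigenvalue α u₀ z * (sigma3 j j - sigma3 i i))) := by
    ext i k
    fin_cases i <;> fin_cases k <;>
      simp [expSigma3, sigma3, ← Complex.exp_add] <;> congr 1 <;> ring
  rw [exp_smul_jostX hα hz hw hγ, ← hdiag, mul_smul_comm, smul_mul_assoc, smul_mulVec,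
    mulVec_mulVec, volterraIntegrand_eq]

theorem im_kz_mul_lamz (hα : α ≠ 0) (hz : z ≠ 0) :
    (kz α u₀ z * lamz u₀ z).im =
      (1 + u₀ ^ 4 / Complex.normSq z ^ 2) / (2 * α) * (z.re * z.im) := by
  have hα' : (α : ℂ) ≠ 0 := Complex.ofReal_ne_zero.2 hα
  have hconj : conj z ≠ 0 := (map_ne_zero _).2 hz
  have hnorm : Complex.normSq z ≠ 0 := Complex.normSq_eq_zero.not.2 hz
  have hprod : kz α u₀ z * lamz u₀ z = ((1 / (4 * α) : ℝ) : ℂ) *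
      (z ^ 2 - ((u₀ ^ 4 / Complex.normSq z ^ 2 : ℝ) : ℂ) * conj z ^ 2) := by
    push_cast [kz, lamz, Complex.normSq_eq_conj_mul_self]
    field_simp
    ring
  rw [hprod]
  simp only [pow_two, Complex.mul_im, Complex.sub_im, Complex.ofReal_re, Complex.ofReal_im,
    Complex.conj_im, Complex.conj_re, Complex.mul_re, Complex.sub_re]
  field_simp
  ring

theorem re_laxEigenvalue (hα : α ≠ 0) (hz : z ≠ 0) :
    (laxEigenvalue α u₀ z).re =
      -((1 + u₀ ^ 4 / Complex.normSq z ^ 2) / (2 * α) * (z.re * z.im)) := by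
  rw [laxEigenvalue, mul_assoc, Complex.I_mul_re, im_kz_mul_lamz hα hz]

theorem re_dir_mul_laxEigenvalue_nonneg (hα : 0 < α) (hz : z ≠ 0) {s : Side} {j : Fin 2}
    (hj : z ∈ columnDomain s j) (i : Fin 2) :
    0 ≤ s.dir * (laxEigenvalue α u₀ z * (sigma3 j j - sigma3 i i)).re := by
  have hr : 0 ≤ (1 + u₀ ^ 4 / Complex.normSq z ^ 2) / (2 * α) := by positivity
  cases s <;> fin_cases j <;> fin_cases i <;>
    simp [columnDomain, closedDPlus, closedDMinus, Side.dir, sigma3,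
      re_laxEigenvalue hα.ne' hz] at hj ⊢ <;> nlinarith

end SpectralData

section JostColumns

variable {α u₀ : ℝ} {w : ℂ} {s : Side} {v : ℝ → ℂ} {z : ℂ} {j : Fin 2} {f : ℝ → Fin 2 → ℂ}

/-- The generator of the Volterra equation of the `j`-th column of `φ_±` after the reflection
`x ↦ ±x`, which moves the normalisation to `+∞` in both cases. -/
def jostGenerator (α u₀ : ℝ) (w : ℂ) (s : Side) (z : ℂ) (j : Fin 2) :
    (Fin 2 → ℂ) →L[ℝ] (Fin 2 → ℂ) :=
  s.dir • mulVecCLM (jostX α u₀ z j w)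

/-- The perturbation in the Volterra equation of the columns of `φ_±` after the reflection
`x ↦ ±x`. -/
def jostPerturbation (α u₀ : ℝ) (w : ℂ) (s : Side) (v : ℝ → ℂ) (z : ℂ) (x : ℝ) :
    (Fin 2 → ℂ) →L[ℝ] (Fin 2 → ℂ) :=
  -s.dir • mulVecCLM (DeltaX α u₀ z w (v (s.dir * x)))

theorem exp_smul_jostGenerator (r : ℝ) :
    NormedSpace.exp (r • jostGenerator α u₀ w s z j) =
      mulVecCLM (NormedSpace.exp ((s.dir * r) • jostX α u₀ z j w)) := by
  rw [mulVecCLM_exp, map_smul, jostGenerator, smul_smul, mul_comm]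

theorem exp_jostGenerator_jostPerturbation (hα : α ≠ 0) (hz : z ≠ 0) (hw : ‖w‖ = u₀)
    (hγ : gam u₀ z ≠ 0) (x y : ℝ) :
    NormedSpace.exp ((x - y) • jostGenerator α u₀ w s z j)
        (jostPerturbation α u₀ w s v z y (f (s.dir * y))) =
      s.sign • volterraIntegrand α u₀ w v z j f (s.dir * x) (s.dir * y) := by
  rw [exp_smul_jostGenerator, volterraIntegrand_eq_exp_mulVec hα hz hw hγ, Side.sign_smul,
    ← mul_sub, jostPerturbation, _root_.smul_apply, map_smul, mulVecCLM_apply,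
    mulVecCLM_apply]

theorem isJostColumn_iff_isTailSolution (hα : α ≠ 0) (hz : z ≠ 0) (hw : ‖w‖ = u₀)
    (hγ : gam u₀ z ≠ 0) :
    IsJostColumn α u₀ w s v z j f ↔ IsTailSolution (jostGenerator α u₀ w s z j)
      (jostPerturbation α u₀ w s v z) ((Ymat w z).col j) fun x => f (s.dir * x) := by
  have hsign : s.sign ≠ 0 := by cases s <;> simp [Side.sign]
  have hiff : ∀ {g : ℝ → Fin 2 → ℂ} {S : Set ℝ},
      IntegrableOn (fun y => s.sign • g y) S ↔ IntegrableOn g S :=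
    integrable_smul_iff hsign _
  have hintegrable : (∀ x, IntegrableOn (volterraIntegrand α u₀ w v z j f x) (s.halfLine x)) ↔
      ∀ x, IntegrableOn (fun y => NormedSpace.exp ((x - y) • jostGenerator α u₀ w s z j)
        (jostPerturbation α u₀ w s v z y (f (s.dir * y)))) (Ioi x) := by
    simp only [exp_jostGenerator_jostPerturbation hα hz hw hγ, hiff]
    rw [s.forall_dir_mul]
    simp only [s.integrableOn_halfLine_iff]
  have heq : (∀ x, f x = (Ymat w z).col j +
      s.sign • ∫ y in s.halfLine x, volterraIntegrand α u₀ w v z j f x y) ↔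
      ∀ x, f (s.dir * x) = (Ymat w z).col j + tailDuhamel (jostGenerator α u₀ w s z j)
        (fun y => jostPerturbation α u₀ w s v z y (f (s.dir * y))) x := by
    simp only [tailDuhamel, exp_jostGenerator_jostPerturbation hα hz hw hγ, integral_smul]
    rw [s.forall_dir_mul]
    simp only [s.setIntegral_halfLine]
  exact ⟨fun h => ⟨hintegrable.1 h.1, heq.1 h.2.1, s.tendsto_toEnd_iff.1 h.2.2⟩,
    fun h => ⟨hintegrable.2 h.1, heq.2 h.2, s.tendsto_toEnd_iff.2 h.3⟩⟩

theorem norm_exp_smul_jostGenerator_le (hα : 0 < α) (hz : z ≠ 0) (hw : ‖w‖ = u₀)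
    (hγ : gam u₀ z ≠ 0) (hj : z ∈ columnDomain s j) {r : ℝ} (hr : r ≤ 0) :
    ‖NormedSpace.exp (r • jostGenerator α u₀ w s z j)‖ ≤
      ‖mulVecCLM (Ymat w z)‖ * ‖mulVecCLM (Ymat w z)⁻¹‖ := by
  rw [exp_smul_jostGenerator, exp_smul_jostX hα.ne' hz hw hγ, map_mul, map_mul]
  refine (norm_mul_le _ _).trans (mul_le_mul_of_nonneg_right ?_ (norm_nonneg _))
  refine (norm_mul_le _ _).trans (mul_le_of_le_one_right (norm_nonneg _) ?_)
  refine norm_mulVecCLM_diagonal_le fun i => ?_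
  rw [Complex.norm_exp, Real.exp_le_one_iff, Complex.re_ofReal_mul, mul_comm s.dir, mul_assoc]
  exact mul_nonpos_of_nonpos_of_nonneg hr (re_dir_mul_laxEigenvalue_nonneg hα hz hj i)

/-- The map `v ↦ ikQ(v)`, which is only real-linear, with values in the operators on `ℂ²`. -/
def perturbationCLM (α u₀ : ℝ) (z : ℂ) : ℂ →L[ℝ] ((Fin 2 → ℂ) →L[ℝ] (Fin 2 → ℂ)) :=
  LinearMap.toContinuousLinearMap
    { toFun := fun v => mulVecCLM ((Complex.I * kz α u₀ z) • Qmat v)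
      map_add' := fun v v' => by
        rw [← map_add, ← smul_add]
        congr 2
        ext i k
        fin_cases i <;> fin_cases k <;> simp [Qmat]
      map_smul' := fun r v => by
        rw [RingHom.id_apply, ← map_smul, smul_comm]
        congr 2
        ext i k
        fin_cases i <;> fin_cases k <;> simp [Qmat] }

theorem jostPerturbation_eq (x : ℝ) :
    jostPerturbation α u₀ w s v z x = -s.dir • perturbationCLM α u₀ z (v (s.dir * x) - w) := by
  rw [map_sub, jostPerturbation, DeltaX, smul_sub, map_sub]
  rfl

theorem continuous_jostPerturbation (hv : Continuous v) :
    Continuous (jostPerturbation α u₀ w s v z) := by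
  rw [funext jostPerturbation_eq]
  exact ((perturbationCLM α u₀ z).continuous.comp
    ((hv.comp s.continuous_dir_mul).sub continuous_const)).const_smul (-s.dir)

theorem integrableOn_jostPerturbation (hv : Continuous v)
    (hi : IntegrableOn (fun x => v x - w) (s.halfLine 0)) (x : ℝ) :
    IntegrableOn (jostPerturbation α u₀ w s v z) (Ioi x) := by
  have hi₀ : IntegrableOn (jostPerturbation α u₀ w s v z) (Ioi 0) := by
    rw [funext jostPerturbation_eq]
    rw [← mul_zero s.dir, s.integrableOn_halfLine_iff] at hi
    exact ((perturbationCLM α u₀ z).integrable_comp hi).smul (-s.dir)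
  refine (((continuous_jostPerturbation hv).integrableOn_Icc (a := x) (b := 0)).union hi₀).mono_set
    fun y hy => ?_
  exact (le_or_gt y 0).imp (fun hy₀ => ⟨(mem_Ioi.1 hy).le, hy₀⟩) id

theorem existsUnique_isJostColumn (hα : 0 < α) (hz : z ≠ 0) (hw : ‖w‖ = u₀) (hγ : gam u₀ z ≠ 0)
    (hv : Continuous v) (hi : IntegrableOn (fun x => v x - w) (s.halfLine 0))
    (hj : z ∈ columnDomain s j) : ∃! f, IsJostColumn α u₀ w s v z j f := by
  have hA : IsTailAdmissible (jostGenerator α u₀ w s z j) (jostPerturbation α u₀ w s v z)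
      (‖mulVecCLM (Ymat w z)‖ * ‖mulVecCLM (Ymat w z)⁻¹‖) :=
    ⟨fun _ hr => norm_exp_smul_jostGenerator_le hα hz hw hγ hj hr, continuous_jostPerturbation hv,
      integrableOn_jostPerturbation hv hi⟩
  simp only [isJostColumn_iff_isTailSolution hα.ne' hz hw hγ]
  obtain ⟨g, hg, hunique⟩ := hA.existsUnique_isTailSolution ((Ymat w z).col j)
  refine ⟨fun x => g (s.dir * x), by simpa only [s.dir_mul_dir_mul] using hg, fun f hf => ?_⟩
  ext1 x
  rw [← hunique _ hf]
  exact congrArg f (s.dir_mul_dir_mul x).symm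

theorem IsJostColumn.hasDerivAt (hα : α ≠ 0) (hz : z ≠ 0) (hw : ‖w‖ = u₀) (hγ : gam u₀ z ≠ 0)
    (hv : Continuous v) (hf : IsJostColumn α u₀ w s v z j f) (x : ℝ) :
    HasDerivAt f (jostX α u₀ z j (v x) *ᵥ f x) x := by
  have hreflected := ((isJostColumn_iff_isTailSolution hα hz hw hγ).1 hf).hasDerivAt
    (continuous_jostPerturbation hv) (s.dir * x)
  have hdir : HasDerivAt (fun x => s.dir * x) s.dir x := by
    simpa using (hasDerivAt_id x).const_mul s.dir
  convert! hreflected.scomp x hdir using 1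
  · ext1 y
    simp only [Function.comp_apply, s.dir_mul_dir_mul]
  · simp only [jostGenerator, jostPerturbation, s.dir_mul_dir_mul, _root_.smul_apply,
      mulVecCLM_apply, mulVec_sub, jostX_mulVec_col hα hz hw, sub_zero, smul_sub, smul_smul]
    have hdir_sq : s.dir * s.dir = 1 := by simpa using s.dir_mul_dir_mul 1
    rw [mul_neg, hdir_sq, one_smul, neg_smul, one_smul, sub_neg_eq_add, ← add_mulVec,
      jostX_add_DeltaX]

end JostColumns

section Transfer

variable {α u₀ : ℝ} {s : Side} {z z' : ℂ} {j j' : Fin 2}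

theorem isJostColumn_comp {w : ℂ} {v : ℝ → ℂ} (T : (Fin 2 → ℂ) →L[ℝ] (Fin 2 → ℂ))
    (hcomp : ∀ f x y, volterraIntegrand α u₀ w v z' j' (fun y => T (f y)) x y =
      T (volterraIntegrand α u₀ w v z j f x y))
    (hcol : T ((Ymat w z).col j) = (Ymat w z').col j') {f : ℝ → Fin 2 → ℂ}
    (hf : IsJostColumn α u₀ w s v z j f) : IsJostColumn α u₀ w s v z' j' fun x => T (f x) := by
  have hcomp' x : volterraIntegrand α u₀ w v z' j' (fun y => T (f y)) x =
      fun y => T (volterraIntegrand α u₀ w v z j f x y) := funext (hcomp f x)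
  obtain ⟨hi, he, ht⟩ := hf
  refine ⟨fun x => ?_, fun x => ?_, ?_⟩
  · rw [hcomp']
    exact T.integrable_comp (hi x)
  · rw [hcomp', T.integral_comp_comm (hi x), s.sign_smul, ← map_smul, ← s.sign_smul]
    exact (congrArg T (he x)).trans ((map_add T _ _).trans (congrArg (· + _) hcol))
  · exact (hcol ▸ (T.continuous.tendsto _).comp ht : Tendsto _ _ (𝓝 ((Ymat w z').col j')))

theorem isJostColumn_comp_iff {w : ℂ} {v : ℝ → ℂ} (T : (Fin 2 → ℂ) ≃L[ℝ] (Fin 2 → ℂ))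
    (hcomp : ∀ f x y, volterraIntegrand α u₀ w v z' j' (fun y => T (f y)) x y =
      T (volterraIntegrand α u₀ w v z j f x y))
    (hcol : T ((Ymat w z).col j) = (Ymat w z').col j') {f : ℝ → Fin 2 → ℂ} :
    IsJostColumn α u₀ w s v z' j' (fun x => T (f x)) ↔ IsJostColumn α u₀ w s v z j f := by
  refine ⟨fun hf => ?_, isJostColumn_comp T.toContinuousLinearMap hcomp hcol⟩
  have hcomp_symm (g : ℝ → Fin 2 → ℂ) (x y : ℝ) :
      volterraIntegrand α u₀ w v z j (fun y => T.symm (g y)) x y =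
        T.symm (volterraIntegrand α u₀ w v z' j' g x y) := by
    rw [T.eq_symm_apply, ← hcomp]
    simp only [T.apply_symm_apply]
  simpa using isJostColumn_comp T.symm.toContinuousLinearMap hcomp_symm
    (T.symm_apply_eq.2 hcol.symm) hf

variable {w : Side → ℂ} {u : ℝ → ℝ → ℂ} {t : ℝ}

theorem isJostColumn_jostColumn
    (h : ∃! f, IsJostColumn α u₀ (w s) s (fun x => u x t) z j f) :
    IsJostColumn α u₀ (w s) s (fun x => u x t) z j (jostColumn α u₀ w s u t z j) := by
  rw [jostColumn, dif_pos h]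
  exact h.choose_spec.1

theorem jostColumn_comp (T : (Fin 2 → ℂ) ≃L[ℝ] (Fin 2 → ℂ))
    (hcomp : ∀ f x y, volterraIntegrand α u₀ (w s) (fun x => u x t) z' j' (fun y => T (f y)) x y =
      T (volterraIntegrand α u₀ (w s) (fun x => u x t) z j f x y))
    (hcol : T ((Ymat (w s) z).col j) = (Ymat (w s) z').col j') (x : ℝ) :
    jostColumn α u₀ w s u t z' j' x = T (jostColumn α u₀ w s u t z j x) := by
  have hiff {f : ℝ → Fin 2 → ℂ} := isJostColumn_comp_iff (s := s) (f := f) T hcomp hcol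
  have hexists : (∃! f, IsJostColumn α u₀ (w s) s (fun x => u x t) z j f) ↔
      ∃! f, IsJostColumn α u₀ (w s) s (fun x => u x t) z' j' f :=
    (Equiv.piCongrRight fun _ : ℝ => T.toEquiv).existsUnique_congr fun _ => hiff.symm
  by_cases h : ∃! f, IsJostColumn α u₀ (w s) s (fun x => u x t) z j f
  · exact congrFun ((hexists.1 h).unique (isJostColumn_jostColumn (hexists.1 h))
      (hiff.2 (isJostColumn_jostColumn h))) x
  · rw [jostColumn, jostColumn, dif_neg h, dif_neg (hexists.not.1 h)]
    exact (map_zero T).symm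

end Transfer

section Wronskian

theorem wr_zero_one_self (A : Matrix (Fin 2) (Fin 2) ℂ) : wr A 0 A 1 = A.det := by
  rw [wr, det_fin_two, mul_comm (A 1 0)]

theorem wr_mul_expSigma3 (A B : Matrix (Fin 2) (Fin 2) ℂ) (c : ℂ) :
    wr (A * expSigma3 c) 0 (B * expSigma3 c) 1 = wr A 0 B 1 := by
  have hexp : Complex.exp c * Complex.exp (-c) = 1 := by
    rw [← Complex.exp_add, add_neg_cancel, Complex.exp_zero]
  simp only [wr, expSigma3, mul_apply, Fin.sum_univ_two, of_apply, cons_val_zero, cons_val_one,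
    cons_val', cons_val_fin_one, mul_zero, add_zero, zero_add]
  linear_combination (A 0 0 * B 1 1 - A 1 0 * B 0 1) * hexp

theorem adjugate_mul_eq_wr (A B : Matrix (Fin 2) (Fin 2) ℂ) :
    A.adjugate * B = !![wr B 0 A 1, wr B 1 A 1; wr A 0 B 0, wr A 0 B 1] := by
  rw [adjugate_fin_two]
  ext i j
  fin_cases i <;> fin_cases j <;> simp [wr, mul_apply] <;> ring

theorem wr_eq_of_hasDerivAt_mulVec {j j' : Fin 2}
    {X A B : ℝ → Matrix (Fin 2) (Fin 2) ℂ}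
    (hX : ∀ x, (X x).trace = 0)
    (hA : ∀ x, HasDerivAt (fun x => (A x).col j) (X x *ᵥ (A x).col j) x)
    (hB : ∀ x, HasDerivAt (fun x => (B x).col j') (X x *ᵥ (B x).col j') x) (x y : ℝ) :
    wr (A x) j (B x) j' = wr (A y) j (B y) j' := by
  have hwr (x : ℝ) : HasDerivAt (fun x => wr (A x) j (B x) j') 0 x := by
    have hA' := hasDerivAt_pi.1 (hA x)
    have hB' := hasDerivAt_pi.1 (hB x)
    convert! ((hA' 0).mul (hB' 1)).sub ((hA' 1).mul (hB' 0)) using 1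
    have htrace := hX x
    rw [trace_fin_two] at htrace
    simp only [mulVec, dotProduct, Fin.sum_univ_two, col_apply]
    linear_combination -(A x 0 j * B x 1 j' - A x 1 j * B x 0 j') * htrace
  exact is_const_of_deriv_eq_zero (fun x => (hwr x).differentiableAt) (fun x => (hwr x).deriv) x y

end Wronskian

section SwapConj

/-- Complex conjugation of a matrix followed by the conjugation with `σ₁` (`ε = 1`) or `σ_*`
(`ε = -1`). -/
def swapConj (ε : ℤˣ) (A : Matrix (Fin 2) (Fin 2) ℂ) : Matrix (Fin 2) (Fin 2) ℂ :=
  !![conj (A 1 1), ε • conj (A 1 0); ε • conj (A 0 1), conj (A 0 0)]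

theorem swapConj_one (A : Matrix (Fin 2) (Fin 2) ℂ) :
    swapConj 1 A = sigma1 * cconj A * sigma1 := by
  rw [eta_fin_two (cconj A)]
  simp [swapConj, sigma1, cconj]

theorem swapConj_neg_one (A : Matrix (Fin 2) (Fin 2) ℂ) :
    swapConj (-1) A = -(sigmaStar * cconj A * sigmaStar) := by
  rw [eta_fin_two (cconj A)]
  simp [swapConj, sigmaStar, cconj]

theorem sigma3_mul_mul_sigma3 (A : Matrix (Fin 2) (Fin 2) ℂ) :
    sigma3 * A * sigma3 = !![A 0 0, -A 0 1; -A 1 0, A 1 1] := by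
  rw [eta_fin_two A]
  simp [sigma3]

theorem swapConj_one_swapConj_neg_one (A : Matrix (Fin 2) (Fin 2) ℂ) :
    swapConj 1 (swapConj (-1) A) = sigma3 * A * sigma3 := by
  rw [sigma3_mul_mul_sigma3]
  simp [swapConj]

theorem swapConj_mul (ε : ℤˣ) (A B : Matrix (Fin 2) (Fin 2) ℂ) :
    swapConj ε (A * B) = swapConj ε A * swapConj ε B := by
  rcases Int.units_eq_one_or ε with rfl | rfl <;> ext i j <;> fin_cases i <;> fin_cases j <;>
    simp [swapConj, mul_apply, add_comm]

theorem swapConj_smul (ε : ℤˣ) (c : ℂ) (A : Matrix (Fin 2) (Fin 2) ℂ) :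
    swapConj ε (c • A) = conj c • swapConj ε A := by
  rcases Int.units_eq_one_or ε with rfl | rfl <;> ext i j <;> fin_cases i <;> fin_cases j <;>
    simp [swapConj]

theorem swapConj_adjugate (ε : ℤˣ) (A : Matrix (Fin 2) (Fin 2) ℂ) :
    swapConj ε A.adjugate = (swapConj ε A).adjugate := by
  rcases Int.units_eq_one_or ε with rfl | rfl <;> ext i j <;> fin_cases i <;> fin_cases j <;>
    simp [swapConj, adjugate_fin_two]

theorem det_swapConj (ε : ℤˣ) (A : Matrix (Fin 2) (Fin 2) ℂ) :
    (swapConj ε A).det = conj A.det := by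
  rcases Int.units_eq_one_or ε with rfl | rfl <;> simp [swapConj, det_fin_two, mul_comm]

theorem swapConj_inv (ε : ℤˣ) (A : Matrix (Fin 2) (Fin 2) ℂ) :
    swapConj ε A⁻¹ = (swapConj ε A)⁻¹ := by
  rw [inv_def, inv_def, swapConj_smul, swapConj_adjugate, det_swapConj, Ring.inverse_eq_inv',
    map_inv₀]

theorem swapConj_expSigma3 (ε : ℤˣ) (c : ℂ) :
    swapConj ε (expSigma3 c) = expSigma3 (-conj c) := by
  ext i j
  fin_cases i <;> fin_cases j <;> simp [swapConj, expSigma3, ← Complex.exp_conj]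

/-- The action of `swapConj ε` on the columns: it sends the `j`-th column of `A` to the column
`1 - j` of `swapConj ε A`. -/
def columnSwap (ε : ℤˣ) (j : Fin 2) : (Fin 2 → ℂ) ≃L[ℝ] (Fin 2 → ℂ) :=
  LinearEquiv.toContinuousLinearEquiv
    { toFun := fun v i => (if i = j then ε else 1) • conj (v (1 - i))
      invFun := fun v i => (if i = 1 - j then ε else 1) • conj (v (1 - i))
      map_add' := fun v v' => by ext i : 1; simp
      map_smul' := fun r v => by ext i : 1; simp [smul_comm r]
      left_inv := fun v => by
        rcases Int.units_eq_one_or ε with rfl | rfl <;> ext i : 1 <;> fin_cases j <;>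
          fin_cases i <;> simp
      right_inv := fun v => by
        rcases Int.units_eq_one_or ε with rfl | rfl <;> ext i : 1 <;> fin_cases j <;>
          fin_cases i <;> simp }

theorem columnSwap_apply (ε : ℤˣ) (j : Fin 2) (v : Fin 2 → ℂ) (i : Fin 2) :
    columnSwap ε j v i = (if i = j then ε else 1) • conj (v (1 - i)) := rfl

theorem columnSwap_smul (ε : ℤˣ) (j : Fin 2) (c : ℂ) (v : Fin 2 → ℂ) :
    columnSwap ε j (c • v) = conj c • columnSwap ε j v := by
  ext i
  simp only [columnSwap_apply, Pi.smul_apply, smul_eq_mul, map_mul, mul_smul_comm]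

theorem columnSwap_col (ε : ℤˣ) (j : Fin 2) (A : Matrix (Fin 2) (Fin 2) ℂ) :
    columnSwap ε j (A.col j) = (swapConj ε A).col (1 - j) := by
  ext i
  fin_cases j <;> fin_cases i <;> simp [columnSwap_apply, swapConj]

theorem swapConj_mulVec_columnSwap (ε : ℤˣ) (j : Fin 2) (A : Matrix (Fin 2) (Fin 2) ℂ)
    (v : Fin 2 → ℂ) : swapConj ε A *ᵥ columnSwap ε j v = columnSwap ε j (A *ᵥ v) := by
  rcases Int.units_eq_one_or ε with rfl | rfl <;> ext i <;> fin_cases j <;> fin_cases i <;>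
    simp [columnSwap_apply, swapConj, mulVec, dotProduct, add_comm]

end SwapConj

section Conjugation

variable (α u₀ : ℝ) (ε : ℤˣ) (z : ℂ)

theorem kz_neg_smul_conj : kz α u₀ (-(ε • conj z)) = -(ε • conj (kz α u₀ z)) := by
  rcases Int.units_eq_one_or ε with rfl | rfl
  · simp [kz, map_ofNat]
    ring
  · simp [kz, map_ofNat]

theorem lamz_neg_smul_conj : lamz u₀ (-(ε • conj z)) = -(ε • conj (lamz u₀ z)) := by
  rcases Int.units_eq_one_or ε with rfl | rfl
  · simp [lamz, map_ofNat]
    ring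
  · simp [lamz, map_ofNat]

theorem gam_neg_smul_conj : gam u₀ (-(ε • conj z)) = conj (gam u₀ z) := by
  rcases Int.units_eq_one_or ε with rfl | rfl <;> simp [gam]

theorem laxEigenvalue_neg_smul_conj :
    laxEigenvalue α u₀ (-(ε • conj z)) = -conj (laxEigenvalue α u₀ z) := by
  rw [laxEigenvalue, kz_neg_smul_conj, lamz_neg_smul_conj]
  rcases Int.units_eq_one_or ε with rfl | rfl <;> simp [laxEigenvalue]

theorem theta_neg_smul_conj (x t : ℝ) :
    theta α u₀ x t (-(ε • conj z)) = conj (theta α u₀ x t z) := by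
  rw [theta, kz_neg_smul_conj, lamz_neg_smul_conj]
  rcases Int.units_eq_one_or ε with rfl | rfl <;> simp [theta, map_ofNat]

theorem Ymat_neg_smul_conj (w : ℂ) : Ymat w (-(ε • conj z)) = swapConj ε (Ymat w z) := by
  rw [Ymat_eq, Ymat_eq]
  rcases Int.units_eq_one_or ε with rfl | rfl <;> ext i j <;> fin_cases i <;> fin_cases j <;>
    simp [swapConj, div_neg]

theorem DeltaX_neg_smul_conj (w v : ℂ) :
    DeltaX α u₀ (-(ε • conj z)) w v = swapConj ε (DeltaX α u₀ z w v) := by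
  rw [DeltaX, DeltaX, kz_neg_smul_conj, swapConj_smul]
  rcases Int.units_eq_one_or ε with rfl | rfl <;> ext i j <;> fin_cases i <;> fin_cases j <;>
    simp [swapConj, Qmat] <;> ring

variable {α u₀ ε z}

theorem volterraIntegrand_columnSwap (w : ℂ) (v : ℝ → ℂ) (j : Fin 2) (f : ℝ → Fin 2 → ℂ)
    (x y : ℝ) :
    volterraIntegrand α u₀ w v (-(ε • conj z)) (1 - j) (fun y => columnSwap ε j (f y)) x y =
      columnSwap ε j (volterraIntegrand α u₀ w v z j f x y) := by
  have hscalar : -conj (laxEigenvalue α u₀ z) * ((x : ℂ) - y) * sigma3 (1 - j) (1 - j) =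
      conj (laxEigenvalue α u₀ z * ((x : ℂ) - y) * sigma3 j j) := by
    fin_cases j <;> simp [sigma3]
  have hmatrix : expSigma3 (-(-conj (laxEigenvalue α u₀ z) * ((x : ℂ) - y))) =
      swapConj ε (expSigma3 (-(laxEigenvalue α u₀ z * ((x : ℂ) - y)))) := by
    simp [swapConj_expSigma3]
  rw [volterraIntegrand_eq, volterraIntegrand_eq, laxEigenvalue_neg_smul_conj, hscalar, hmatrix,
    Ymat_neg_smul_conj, DeltaX_neg_smul_conj, ← swapConj_inv, ← swapConj_mul, ← swapConj_mul,
    ← swapConj_mul, swapConj_mulVec_columnSwap, columnSwap_smul, ← Complex.exp_conj]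

variable (w : Side → ℂ) (s : Side) (u : ℝ → ℝ → ℂ) (x t : ℝ)

theorem jost_neg_smul_conj :
    jost α u₀ w s u x t (-(ε • conj z)) = swapConj ε (jost α u₀ w s u x t z) := by
  refine ext_col fun j => ?_
  obtain ⟨j, rfl⟩ : ∃ k, j = 1 - k := ⟨1 - j, (sub_sub_cancel 1 j).symm⟩
  rw [← columnSwap_col]
  exact jostColumn_comp (columnSwap ε j) (volterraIntegrand_columnSwap _ _ j)
    (by rw [columnSwap_col, Ymat_neg_smul_conj]) x

theorem laxJost_neg_smul_conj :
    laxJost α u₀ w s u x t (-(ε • conj z)) = swapConj ε (laxJost α u₀ w s u x t z) := by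
  rw [laxJost, laxJost, swapConj_mul, swapConj_expSigma3, jost_neg_smul_conj,
    theta_neg_smul_conj, map_mul, Complex.conj_I, neg_mul, neg_neg]

theorem scatteringMatrix_eq :
    scatteringMatrix α u₀ w u t z = (gam u₀ z)⁻¹ •
      ((laxJost α u₀ w .minus u 0 t z).adjugate * laxJost α u₀ w .plus u 0 t z) := by
  rw [scatteringMatrix, adjugate_mul_eq_wr]

theorem scatteringMatrix_neg_smul_conj :
    scatteringMatrix α u₀ w u t (-(ε • conj z)) = swapConj ε (scatteringMatrix α u₀ w u t z) := by
  simp only [scatteringMatrix_eq, swapConj_smul, swapConj_mul, swapConj_adjugate,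
    laxJost_neg_smul_conj, gam_neg_smul_conj, map_inv₀]

theorem rho_neg_smul_conj :
    rho α u₀ w u t (-(ε • conj z)) = ε • conj (rhoTilde α u₀ w u t z) := by
  rw [rho, scatteringMatrix_neg_smul_conj, rhoTilde, map_div₀, ← smul_div_assoc]
  rfl

theorem jost_eq_conj : jost α u₀ w s u x t z =
    -(sigmaStar * cconj (jost α u₀ w s u x t (conj z)) * sigmaStar) := by
  rw [← swapConj_neg_one, ← jost_neg_smul_conj]
  simp

theorem scatteringMatrix_eq_conj : scatteringMatrix α u₀ w u t z =
    -(sigmaStar * cconj (scatteringMatrix α u₀ w u t (conj z)) * sigmaStar) := by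
  rw [← swapConj_neg_one, ← scatteringMatrix_neg_smul_conj]
  simp

theorem rho_eq_conj : rho α u₀ w u t z = -conj (rhoTilde α u₀ w u t (conj z)) := by
  simpa using rho_neg_smul_conj (ε := -1) (z := conj z) w u t

theorem jost_eq_neg_conj : jost α u₀ w s u x t z =
    sigma1 * cconj (jost α u₀ w s u x t (-conj z)) * sigma1 := by
  rw [← swapConj_one, ← jost_neg_smul_conj]
  simp

theorem scatteringMatrix_eq_neg_conj : scatteringMatrix α u₀ w u t z =
    sigma1 * cconj (scatteringMatrix α u₀ w u t (-conj z)) * sigma1 := by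
  rw [← swapConj_one, ← scatteringMatrix_neg_smul_conj]
  simp

theorem rho_eq_neg_conj : rho α u₀ w u t z = conj (rhoTilde α u₀ w u t (-conj z)) := by
  simpa using rho_neg_smul_conj (ε := 1) (z := -conj z) w u t

theorem scatteringMatrix_neg :
    scatteringMatrix α u₀ w u t (-z) = sigma3 * scatteringMatrix α u₀ w u t z * sigma3 := by
  rw [← swapConj_one_swapConj_neg_one, ← scatteringMatrix_neg_smul_conj,
    ← scatteringMatrix_neg_smul_conj]
  simp

end Conjugation

section Inversion

/-- The matrix `z⁻¹ σ₃ Q_±` relating the values of `φ_±` at `z` and at `-u₀² / z`. -/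
def inversionMat (w z : ℂ) : Matrix (Fin 2) (Fin 2) ℂ := z⁻¹ • (sigma3 * Qmat w)

theorem inversionMat_eq (w z : ℂ) : inversionMat w z = !![0, w / z; -(conj w / z), 0] := by
  ext i j
  fin_cases i <;> fin_cases j <;> simp [inversionMat, sigma3, Qmat, div_eq_inv_mul]

theorem expSigma3_mul_inversionMat (c w z : ℂ) :
    expSigma3 c * inversionMat w z = inversionMat w z * expSigma3 (-c) := by
  simp [inversionMat_eq, expSigma3, mul_comm]

variable {α u₀ : ℝ} {z : ℂ}

theorem det_sigma3_mul_Qmat {w : ℂ} (hw : ‖w‖ = u₀) : (sigma3 * Qmat w).det = (u₀ : ℂ) ^ 2 := by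
  simp [sigma3, Qmat, det_fin_two, mul_conj_eq_sq hw]

theorem det_inversionMat {w : ℂ} (hw : ‖w‖ = u₀) :
    (inversionMat w z).det = (u₀ : ℂ) ^ 2 / z ^ 2 := by
  rw [inversionMat, det_smul, det_sigma3_mul_Qmat hw, Fintype.card_fin, inv_pow, div_eq_inv_mul]

theorem isUnit_det_inversionMat (hu₀ : u₀ ≠ 0) (hz : z ≠ 0) {w : ℂ} (hw : ‖w‖ = u₀) :
    IsUnit (inversionMat w z).det := by
  rw [det_inversionMat hw, isUnit_iff_ne_zero]
  exact div_ne_zero (pow_ne_zero 2 (Complex.ofReal_ne_zero.2 hu₀)) (pow_ne_zero 2 hz)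

theorem kz_inversion (hu₀ : u₀ ≠ 0) (hz : z ≠ 0) : kz α u₀ (-(u₀ : ℂ) ^ 2 / z) = kz α u₀ z := by
  have hu₀' : (u₀ : ℂ) ≠ 0 := Complex.ofReal_ne_zero.2 hu₀
  rw [kz, kz]
  field_simp
  ring

theorem lamz_inversion (hu₀ : u₀ ≠ 0) (hz : z ≠ 0) :
    lamz u₀ (-(u₀ : ℂ) ^ 2 / z) = -lamz u₀ z := by
  have hu₀' : (u₀ : ℂ) ≠ 0 := Complex.ofReal_ne_zero.2 hu₀
  rw [lamz, lamz]
  field_simp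
  ring

theorem gam_inversion (hu₀ : u₀ ≠ 0) (hz : z ≠ 0) :
    gam u₀ (-(u₀ : ℂ) ^ 2 / z) = z ^ 2 / (u₀ : ℂ) ^ 2 * gam u₀ z := by
  have hu₀' : (u₀ : ℂ) ≠ 0 := Complex.ofReal_ne_zero.2 hu₀
  rw [gam, gam]
  field_simp
  ring

theorem laxEigenvalue_inversion (hu₀ : u₀ ≠ 0) (hz : z ≠ 0) :
    laxEigenvalue α u₀ (-(u₀ : ℂ) ^ 2 / z) = -laxEigenvalue α u₀ z := by
  rw [laxEigenvalue, kz_inversion hu₀ hz, lamz_inversion hu₀ hz, mul_neg, laxEigenvalue]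

theorem theta_inversion (hu₀ : u₀ ≠ 0) (hz : z ≠ 0) (x t : ℝ) :
    theta α u₀ x t (-(u₀ : ℂ) ^ 2 / z) = -theta α u₀ x t z := by
  rw [theta, kz_inversion hu₀ hz, lamz_inversion hu₀ hz, mul_neg, neg_mul, theta]

theorem DeltaX_inversion (hu₀ : u₀ ≠ 0) (hz : z ≠ 0) (w v : ℂ) :
    DeltaX α u₀ (-(u₀ : ℂ) ^ 2 / z) w v = DeltaX α u₀ z w v := by
  rw [DeltaX, kz_inversion hu₀ hz, DeltaX]

theorem Ymat_inversion_mul (hu₀ : u₀ ≠ 0) (hz : z ≠ 0) {w : ℂ} (hw : ‖w‖ = u₀) :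
    Ymat w (-(u₀ : ℂ) ^ 2 / z) * inversionMat w z = Ymat w z := by
  have hu₀' : (u₀ : ℂ) ≠ 0 := Complex.ofReal_ne_zero.2 hu₀
  have hsq := mul_conj_eq_sq hw
  have hoff : w / (-(u₀ : ℂ) ^ 2 / z) * -(conj w / z) = 1 := by
    field_simp
    exact hsq
  have hoff' : -(conj w / (-(u₀ : ℂ) ^ 2 / z)) * (w / z) = 1 := by
    rw [← hoff]
    ring
  rw [Ymat_eq, Ymat_eq, inversionMat_eq, mul_fin_two, hoff, hoff']
  simp

theorem volterraIntegrand_inversion (hu₀ : u₀ ≠ 0) (hz : z ≠ 0) {w : ℂ} (hw : ‖w‖ = u₀)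
    (v : ℝ → ℂ) (j : Fin 2) (f : ℝ → Fin 2 → ℂ) (x y : ℝ) :
    volterraIntegrand α u₀ w v (-(u₀ : ℂ) ^ 2 / z) (1 - j) f x y =
      volterraIntegrand α u₀ w v z j f x y := by
  have hscalar (c : ℂ) : -c * sigma3 (1 - j) (1 - j) = c * sigma3 j j := by
    fin_cases j <;> simp [sigma3]
  have hconj (c : ℂ) : Ymat w z * expSigma3 c * (Ymat w z)⁻¹ =
      Ymat w (-(u₀ : ℂ) ^ 2 / z) * expSigma3 (-c) * (Ymat w (-(u₀ : ℂ) ^ 2 / z))⁻¹ := by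
    rw [← Ymat_inversion_mul hu₀ hz hw, Matrix.mul_inv_rev, mul_assoc (Ymat w _),
      ← neg_neg c, ← expSigma3_mul_inversionMat, neg_neg, ← mul_assoc (Ymat w _), ← mul_assoc,
      mul_nonsing_inv_cancel_right _ _ (isUnit_det_inversionMat hu₀ hz hw)]
  rw [volterraIntegrand_eq, volterraIntegrand_eq, hconj, laxEigenvalue_inversion hu₀ hz,
    DeltaX_inversion hu₀ hz, neg_mul, hscalar]

theorem volterraIntegrand_smul (c : ℂ) (w : ℂ) (v : ℝ → ℂ) (j : Fin 2) (f : ℝ → Fin 2 → ℂ)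
    (x y : ℝ) : volterraIntegrand α u₀ w v z j (fun y => c • f y) x y =
      c • volterraIntegrand α u₀ w v z j f x y := by
  rw [volterraIntegrand, volterraIntegrand, mulVec_smul, smul_comm]

variable {w : Side → ℂ} (u : ℝ → ℝ → ℂ) (x t : ℝ)

theorem jost_eq_mul_inversionMat (hu₀ : u₀ ≠ 0) (hz : z ≠ 0) {s : Side} (hw : ‖w s‖ = u₀) :
    jost α u₀ w s u x t z =
      jost α u₀ w s u x t (-(u₀ : ℂ) ^ 2 / z) * inversionMat (w s) z := by
  have hcol (A : Matrix (Fin 2) (Fin 2) ℂ) (j : Fin 2) : (A * inversionMat (w s) z).col j =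
      inversionMat (w s) z (1 - j) j • A.col (1 - j) := by
    ext i
    fin_cases j <;> simp [inversionMat_eq, mul_apply, mul_comm]
  have hne (j : Fin 2) : inversionMat (w s) z (1 - j) j ≠ 0 := by
    have hw' : w s ≠ 0 := fun h => hu₀ (by rw [← hw, h, norm_zero])
    fin_cases j <;> simp [inversionMat_eq, hw', hz]
  refine ext_col fun j => ?_
  rw [hcol]
  refine jostColumn_comp (ContinuousLinearEquiv.smulLeft (Units.mk0 _ (hne j)))
    (fun f x y => (volterraIntegrand_smul _ _ _ _ _ _ _).trans
      (congrArg _ (volterraIntegrand_inversion hu₀ hz hw _ j f x y).symm)) ?_ x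
  rw [← Ymat_inversion_mul hu₀ hz hw, hcol]
  rfl

theorem laxJost_eq_mul_inversionMat (hu₀ : u₀ ≠ 0) (hz : z ≠ 0) {s : Side} (hw : ‖w s‖ = u₀) :
    laxJost α u₀ w s u x t z =
      laxJost α u₀ w s u x t (-(u₀ : ℂ) ^ 2 / z) * inversionMat (w s) z := by
  rw [laxJost, laxJost, theta_inversion hu₀ hz, mul_neg, mul_assoc, expSigma3_mul_inversionMat,
    neg_neg, ← mul_assoc, ← jost_eq_mul_inversionMat u x t hu₀ hz hw]

theorem jost_inversion (hu₀ : u₀ ≠ 0) (hz : z ≠ 0) {s : Side} (hw : ‖w s‖ = u₀) :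
    jost α u₀ w s u x t z =
      z⁻¹ • (jost α u₀ w s u x t (-(u₀ : ℂ) ^ 2 / z) * (sigma3 * Qmat (w s))) := by
  rw [jost_eq_mul_inversionMat u x t hu₀ hz hw, inversionMat, mul_smul_comm]

theorem scatteringMatrix_inversion (hu₀ : u₀ ≠ 0) (hz : z ≠ 0) (hw : ∀ s, ‖w s‖ = u₀) :
    scatteringMatrix α u₀ w u t z = (sigma3 * Qmat (w .minus))⁻¹ *
      scatteringMatrix α u₀ w u t (-(u₀ : ℂ) ^ 2 / z) * (sigma3 * Qmat (w .plus)) := by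
  have hu₀' : (u₀ : ℂ) ≠ 0 := Complex.ofReal_ne_zero.2 hu₀
  rw [scatteringMatrix_eq, scatteringMatrix_eq, laxJost_eq_mul_inversionMat u 0 t hu₀ hz (hw _),
    laxJost_eq_mul_inversionMat u 0 t hu₀ hz (hw _), gam_inversion hu₀ hz, adjugate_mul_distrib,
    inversionMat, inversionMat, inv_def, det_sigma3_mul_Qmat (hw _), adjugate_smul,
    Ring.inverse_eq_inv']
  simp only [Fintype.card_fin, smul_mul_assoc, mul_smul_comm, smul_smul, mul_assoc]
  congr 1
  rw [show 2 - 1 = 1 from rfl, pow_one]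
  field_simp

theorem rho_inversion (hu₀ : u₀ ≠ 0) (hz : z ≠ 0) (hw : ∀ s, ‖w s‖ = u₀) :
    rho α u₀ w u t z =
      -(conj (w .minus) / w .minus) * rhoTilde α u₀ w u t (-(u₀ : ℂ) ^ 2 / z) := by
  have hu₀' : (u₀ : ℂ) ≠ 0 := Complex.ofReal_ne_zero.2 hu₀
  have hne (s : Side) : w s ≠ 0 := fun h => hu₀ (by rw [← hw s, h, norm_zero])
  have hne' : conj (w .plus) ≠ 0 := (map_ne_zero _).2 (hne _)
  rw [rho, rhoTilde, scatteringMatrix_inversion u t hu₀ hz hw]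
  generalize scatteringMatrix α u₀ w u t (-(u₀ : ℂ) ^ 2 / z) = S
  have h10 : ((sigma3 * Qmat (w .minus))⁻¹ * S * (sigma3 * Qmat (w .plus))) 1 0 =
      -(conj (w .minus) * conj (w .plus) / (u₀ : ℂ) ^ 2) * S 0 1 := by
    rw [inv_def, det_sigma3_mul_Qmat (hw _), Ring.inverse_eq_inv']
    rw [eta_fin_two S]
    simp [adjugate_fin_two, sigma3, Qmat]
    ring
  have h00 : ((sigma3 * Qmat (w .minus))⁻¹ * S * (sigma3 * Qmat (w .plus))) 0 0 =
      w .minus * conj (w .plus) / (u₀ : ℂ) ^ 2 * S 1 1 := by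
    rw [inv_def, det_sigma3_mul_Qmat (hw _), Ring.inverse_eq_inv']
    rw [eta_fin_two S]
    simp [adjugate_fin_two, sigma3, Qmat]
    ring
  have hminus := hne .minus
  rw [h10, h00]
  field_simp

end Inversion

section Scattering

variable {α u₀ : ℝ} {w : Side → ℂ} {s s' : Side} {u : ℝ → ℝ → ℂ} {t : ℝ} {z : ℂ} {j j' : Fin 2}

theorem wr_laxJost_zero_one (α u₀ : ℝ) (w : Side → ℂ) (s s' : Side) (u : ℝ → ℝ → ℂ) (x t : ℝ)
    (z : ℂ) : wr (laxJost α u₀ w s u x t z) 0 (laxJost α u₀ w s' u x t z) 1 =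
      wr (jost α u₀ w s u x t z) 0 (jost α u₀ w s' u x t z) 1 :=
  wr_mul_expSigma3 _ _ _

theorem trace_laxX (v : ℂ) : (laxX α u₀ z v).trace = 0 := by
  simp [laxX, trace_fin_two, Qmat, sigma3]

theorem laxJost_col (x : ℝ) : (laxJost α u₀ w s u x t z).col j =
    Complex.exp (Complex.I * theta α u₀ x t z * sigma3 j j) • jostColumn α u₀ w s u t z j x := by
  ext i
  fin_cases j <;> simp [laxJost, jost, expSigma3, sigma3, mul_apply, mul_comm]

theorem hasDerivAt_I_mul_theta (x : ℝ) :
    HasDerivAt (fun x : ℝ => Complex.I * theta α u₀ x t z) (-laxEigenvalue α u₀ z) x := by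
  have hx : HasDerivAt (fun x : ℝ => (x : ℂ)) 1 x := Complex.ofRealCLM.hasDerivAt
  convert! ((hx.add_const _).const_mul (-(kz α u₀ z * lamz u₀ z))).const_mul Complex.I using 1
  rw [laxEigenvalue]
  ring

theorem hasDerivAt_laxJost_col (hα : α ≠ 0) (hz : z ≠ 0) (hw : ‖w s‖ = u₀) (hγ : gam u₀ z ≠ 0)
    (hu : Continuous fun x => u x t)
    (h : ∃! f, IsJostColumn α u₀ (w s) s (fun x => u x t) z j f) (x : ℝ) :
    HasDerivAt (fun x => (laxJost α u₀ w s u x t z).col j)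
      (laxX α u₀ z (u x t) *ᵥ (laxJost α u₀ w s u x t z).col j) x := by
  have hjost := (isJostColumn_jostColumn h).hasDerivAt hα hz hw hγ hu x
  have hexp := ((hasDerivAt_I_mul_theta (α := α) (u₀ := u₀) (t := t) (z := z) x).mul_const
    (sigma3 j j)).cexp
  simp only [laxJost_col]
  convert! hexp.smul hjost using 1
  rw [jostX, add_mulVec, smul_mulVec, one_mulVec, mulVec_smul]
  module

theorem wr_laxJost_eq (hα : α ≠ 0) (hz : z ≠ 0) (hw : ∀ s, ‖w s‖ = u₀) (hγ : gam u₀ z ≠ 0)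
    (hu : Continuous fun x => u x t)
    (h : ∃! f, IsJostColumn α u₀ (w s) s (fun x => u x t) z j f)
    (h' : ∃! f, IsJostColumn α u₀ (w s') s' (fun x => u x t) z j' f) (x y : ℝ) :
    wr (laxJost α u₀ w s u x t z) j (laxJost α u₀ w s' u x t z) j' =
      wr (laxJost α u₀ w s u y t z) j (laxJost α u₀ w s' u y t z) j' :=
  wr_eq_of_hasDerivAt_mulVec (fun x => trace_laxX (u x t))
    (hasDerivAt_laxJost_col hα hz (hw s) hγ hu h) (hasDerivAt_laxJost_col hα hz (hw s') hγ hu h')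
    x y

theorem scatteringMatrix_zero_zero (hα : α ≠ 0) (hz : z ≠ 0) (hw : ∀ s, ‖w s‖ = u₀)
    (hγ : gam u₀ z ≠ 0) (hu : Continuous fun x => u x t)
    (hplus : ∃! f, IsJostColumn α u₀ (w .plus) .plus (fun x => u x t) z 0 f)
    (hminus : ∃! f, IsJostColumn α u₀ (w .minus) .minus (fun x => u x t) z 1 f) (x : ℝ) :
    scatteringMatrix α u₀ w u t z 0 0 =
      wr (jost α u₀ w .plus u x t z) 0 (jost α u₀ w .minus u x t z) 1 / gam u₀ z := by
  rw [← wr_laxJost_zero_one, wr_laxJost_eq hα hz hw hγ hu hplus hminus x 0, div_eq_inv_mul]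
  rfl

theorem scatteringMatrix_one_one (hα : α ≠ 0) (hz : z ≠ 0) (hw : ∀ s, ‖w s‖ = u₀)
    (hγ : gam u₀ z ≠ 0) (hu : Continuous fun x => u x t)
    (hminus : ∃! f, IsJostColumn α u₀ (w .minus) .minus (fun x => u x t) z 0 f)
    (hplus : ∃! f, IsJostColumn α u₀ (w .plus) .plus (fun x => u x t) z 1 f) (x : ℝ) :
    scatteringMatrix α u₀ w u t z 1 1 =
      wr (jost α u₀ w .minus u x t z) 0 (jost α u₀ w .plus u x t z) 1 / gam u₀ z := by
  rw [← wr_laxJost_zero_one, wr_laxJost_eq hα hz hw hγ hu hminus hplus x 0, div_eq_inv_mul]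
  rfl

theorem tendsto_det_jost (hw : ‖w s‖ = u₀)
    (h : ∀ j, ∃! f, IsJostColumn α u₀ (w s) s (fun x => u x t) z j f) :
    Tendsto (fun x => (jost α u₀ w s u x t z).det) s.toEnd (𝓝 (gam u₀ z)) := by
  have hentry (i j : Fin 2) :
      Tendsto (fun x => jost α u₀ w s u x t z i j) s.toEnd (𝓝 (Ymat (w s) z i j)) :=
    tendsto_pi_nhds.1 (isJostColumn_jostColumn (h j)).2.2 i
  simp only [det_fin_two, ← det_Ymat hw z]
  exact ((hentry 0 0).mul (hentry 1 1)).sub ((hentry 0 1).mul (hentry 1 0))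

theorem det_laxJost (hα : α ≠ 0) (hz : z ≠ 0) (hw : ∀ s, ‖w s‖ = u₀) (hγ : gam u₀ z ≠ 0)
    (hu : Continuous fun x => u x t)
    (h : ∀ j, ∃! f, IsJostColumn α u₀ (w s) s (fun x => u x t) z j f) (x : ℝ) :
    (laxJost α u₀ w s u x t z).det = gam u₀ z := by
  refine tendsto_nhds_unique (tendsto_const_nhds.congr fun y => ?_) (tendsto_det_jost (hw s) h)
  rw [← wr_zero_one_self, wr_laxJost_eq hα hz hw hγ hu (h 0) (h 1) x y, wr_laxJost_zero_one,
    wr_zero_one_self]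

theorem scatteringMatrix_eq_inv_mul (hα : α ≠ 0) (hz : z ≠ 0) (hw : ∀ s, ‖w s‖ = u₀)
    (hγ : gam u₀ z ≠ 0) (hu : Continuous fun x => u x t)
    (h : ∀ s j, ∃! f, IsJostColumn α u₀ (w s) s (fun x => u x t) z j f) (x : ℝ) :
    scatteringMatrix α u₀ w u t z =
      (laxJost α u₀ w .minus u x t z)⁻¹ * laxJost α u₀ w .plus u x t z := by
  have hwr {s s' : Side} {j j' : Fin 2} := wr_laxJost_eq hα hz hw hγ hu (h s j) (h s' j') 0 x
  rw [inv_def, det_laxJost hα hz hw hγ hu (h _), Ring.inverse_eq_inv', smul_mul_assoc,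
    adjugate_mul_eq_wr, scatteringMatrix]
  simp only [hwr]

theorem laxJost_plus_eq_mul_iff (hα : α ≠ 0) (hz : z ≠ 0) (hw : ∀ s, ‖w s‖ = u₀)
    (hγ : gam u₀ z ≠ 0) (hu : Continuous fun x => u x t)
    (h : ∀ s j, ∃! f, IsJostColumn α u₀ (w s) s (fun x => u x t) z j f)
    (x : ℝ) (S : Matrix (Fin 2) (Fin 2) ℂ) :
    laxJost α u₀ w .plus u x t z = laxJost α u₀ w .minus u x t z * S ↔
      S = scatteringMatrix α u₀ w u t z := by
  have hdet : IsUnit (laxJost α u₀ w .minus u x t z).det := by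
    rwa [det_laxJost hα hz hw hγ hu (h _), isUnit_iff_ne_zero]
  rw [scatteringMatrix_eq_inv_mul hα hz hw hγ hu h x]
  refine ⟨fun hS => ?_, fun hS => ?_⟩
  · rw [hS, nonsing_inv_mul_cancel_left _ _ hdet]
  · rw [hS, mul_nonsing_inv_cancel_left _ _ hdet]

theorem mem_columnDomain_of_mem_contour (hz : z ∈ contour) (s : Side) (j : Fin 2) :
    z ∈ columnDomain s j := by
  cases s <;> fin_cases j <;> first | exact le_of_eq hz | exact ge_of_eq hz

end Scattering

end

end MNLS

theorem mainTheorem3 (α u₀ : ℝ) (hα : 0 < α) (hu₀ : 0 < u₀)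
    (w : Side → ℂ) (hw : ∀ s, ‖w s‖ = u₀)
    (u : ℝ → ℝ → ℂ) (hcont : ∀ t, Continuous fun x => u x t)
    (hminus : ∀ t, IntegrableOn (fun x => u x t - w .minus) (Iic 0))
    (hplus : ∀ t, IntegrableOn (fun x => u x t - w .plus) (Ici 0))
    (t : ℝ) (z : ℂ) (hz : z ≠ 0) (hz' : z ^ 2 ≠ -(u₀ : ℂ) ^ 2) :
    -- the columns of the Jost solutions are well defined on their regions
    (∀ s j, z ∈ columnDomain s j →
      ∃! f, IsJostColumn α u₀ (w s) s (fun x => u x t) z j f) ∧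
    -- on the contour, `S` is the matrix that relates the two Jost solutions
    (z ∈ contour →
      (∀ x, laxJost α u₀ w .plus u x t z =
        laxJost α u₀ w .minus u x t z * scatteringMatrix α u₀ w u t z) ∧
      ∀ S : Matrix (Fin 2) (Fin 2) ℂ,
        (∀ x, laxJost α u₀ w .plus u x t z = laxJost α u₀ w .minus u x t z * S) →
          S = scatteringMatrix α u₀ w u t z) ∧
    -- off the contour, `s₁₁` and `s₂₂` are Wronskians that do not depend on `x`
    (z ∈ closedDPlus → ∀ x, scatteringMatrix α u₀ w u t z 0 0 =
      wr (jost α u₀ w .plus u x t z) 0 (jost α u₀ w .minus u x t z) 1 / gam u₀ z) ∧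
    (z ∈ closedDMinus → ∀ x, scatteringMatrix α u₀ w u t z 1 1 =
      wr (jost α u₀ w .minus u x t z) 0 (jost α u₀ w .plus u x t z) 1 / gam u₀ z) ∧
    -- first symmetry, `z ↦ z^*`
    (∀ s x, jost α u₀ w s u x t z =
      -(sigmaStar * cconj (jost α u₀ w s u x t (conj z)) * sigmaStar)) ∧
    scatteringMatrix α u₀ w u t z =
      -(sigmaStar * cconj (scatteringMatrix α u₀ w u t (conj z)) * sigmaStar) ∧
    rho α u₀ w u t z = -conj (rhoTilde α u₀ w u t (conj z)) ∧
    -- first symmetry, `z ↦ -z^*`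
    (∀ s x, jost α u₀ w s u x t z =
      sigma1 * cconj (jost α u₀ w s u x t (-conj z)) * sigma1) ∧
    scatteringMatrix α u₀ w u t z =
      sigma1 * cconj (scatteringMatrix α u₀ w u t (-conj z)) * sigma1 ∧
    rho α u₀ w u t z = conj (rhoTilde α u₀ w u t (-conj z)) ∧
    -- second symmetry, `z ↦ -u₀² / z`
    (∀ s x, jost α u₀ w s u x t z =
      z⁻¹ • (jost α u₀ w s u x t (-(u₀ : ℂ) ^ 2 / z) * (sigma3 * Qmat (w s)))) ∧
    scatteringMatrix α u₀ w u t z =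
      (sigma3 * Qmat (w .minus))⁻¹ * scatteringMatrix α u₀ w u t (-(u₀ : ℂ) ^ 2 / z) *
        (sigma3 * Qmat (w .plus)) ∧
    rho α u₀ w u t z =
      -(conj (w .minus) / w .minus) * rhoTilde α u₀ w u t (-(u₀ : ℂ) ^ 2 / z) ∧
    -- parity
    scatteringMatrix α u₀ w u t (-z) 0 0 = scatteringMatrix α u₀ w u t z 0 0 ∧
    scatteringMatrix α u₀ w u t (-z) 1 1 = scatteringMatrix α u₀ w u t z 1 1 ∧
    scatteringMatrix α u₀ w u t (-z) 0 1 = -scatteringMatrix α u₀ w u t z 0 1 ∧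
    scatteringMatrix α u₀ w u t (-z) 1 0 = -scatteringMatrix α u₀ w u t z 1 0 := by
  have hγ := gam_ne_zero hz hz'
  have hex (s : Side) (j : Fin 2) (hj : z ∈ columnDomain s j) :
      ∃! f, IsJostColumn α u₀ (w s) s (fun x => u x t) z j f := by
    refine existsUnique_isJostColumn hα hz (hw s) hγ (hcont t) ?_ hj
    cases s with
    | minus => exact hminus t
    | plus => exact (hplus t).mono_set Ioi_subset_Ici_self
  refine ⟨hex, fun hcontour => ?_,
    fun hD => scatteringMatrix_zero_zero hα.ne' hz hw hγ (hcont t) (hex _ _ hD) (hex _ _ hD),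
    fun hD => scatteringMatrix_one_one hα.ne' hz hw hγ (hcont t) (hex _ _ hD) (hex _ _ hD),
    fun s x => jost_eq_conj w s u x t, scatteringMatrix_eq_conj w u t, rho_eq_conj w u t,
    fun s x => jost_eq_neg_conj w s u x t, scatteringMatrix_eq_neg_conj w u t,
    rho_eq_neg_conj w u t, fun s x => jost_inversion u x t hu₀.ne' hz (hw s),
    scatteringMatrix_inversion u t hu₀.ne' hz hw, rho_inversion u t hu₀.ne' hz hw, ?_⟩
  · have hiff := laxJost_plus_eq_mul_iff hα.ne' hz hw hγ (hcont t) fun s j =>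
      hex s j (mem_columnDomain_of_mem_contour hcontour s j)
    exact ⟨fun x => (hiff x _).2 rfl, fun S hS => (hiff 0 S).1 (hS 0)⟩
  · rw [scatteringMatrix_neg, sigma3_mul_mul_sigma3]
    exact ⟨rfl, rfl, rfl, rfl⟩
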